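/- Let $\lambda\ge 1$ be a number of colors. For each color $i\in\{1,\dots,\lambda\}$ let $R_{i1},\dots,R_{iq_i}$ be finite directed networks (parallel arcs and loops are allowed) with arcs colored in $1,\dots,\lambda$, each with two distinct marked nodes $A$ and $B$, and let $p_{i1},\dots,p_{iq_i}\ge 0$ with $\sum_{k}p_{ik}=1$. Let $G^0$ be a finite directed network with colored arcs and at least one arc. Given $G^t$, the network $G^{t+1}$ is obtained by replacing all arcs of $G^t$ simultaneously and independently, where an arc $e$ of color $i$ is replaced by a fresh copy of $R_{ik}$ with probability $p_{ik}$; the node $A$ of the copy is identified with the beginning node of $e$ and the node $B$ with its end node. The choices at each step are independent of those at all earlier steps. Degrees are total degrees (in-degree plus out-degree), and distances are measured ignoring arc directions, with distance $\infty$ between nodes that are not joined by a path. Assume that * whenever $p_{ik}>0$, the nodes $A$ and $B$ of $R_{ik}$ both have degree at least $1$; * for each color $i$ there is a $k$ with $p_{ik}>0$ such that the distance between $A$ and $B$ in $R_{ik}$ is greater than $1$, and a $k'$ with $p_{ik'}>0$ such that at least one of $A$ and $B$ has degree greater than $1$ in $R_{ik'}$. For a network $G$ let $\boldsymbol\chi(G)$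 be the row vector whose $j$-th entry is the number of $j$-colored arcs of $G$, and let $\mathbf M$ be the $\lambda\times\lambda$ matrix with entries $\mathbf M_{ij}=\sum_{k=1}^{q_i}p_{ik}\,[\boldsymbol\chi(R_{ik})]_j$. Assume that $\mathbf M$ is primitive, that is, some positive power of $\mathbf M$ has only positive entries. Then, for every $t\ge 0$, the vector $\boldsymbol\chi(G^t)$ is integrable with $$\mathbb E(\boldsymbol\chi(G^t))=\boldsymbol\chi(G^0)\,\mathbf M^t ,$$ and almost surely $\boldsymbol\chi(G^t)\overset{t\to\infty}{\asymp}\mathbb E(\boldsymbol\chi(G^t))$; that is, with probability $1$ there is a constant $c>0$ (depending on the realization of the sequence $G^0,G^1,\dots$) such that, for every color $j$, $$\lim_{t\to\infty}\frac{[\boldsymbol\chi(G^t)]_j}{[\mathbb E(\boldsymbol\chi(G^t))]_j}=c .$$ -/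

import Mathlib

open MeasureTheory ProbabilityTheory Filter Topology

noncomputable section

/-- A finite directed network (parallel arcs and loops allowed) with arcs coloured by `Fin L`. -/
structure ColoredNetwork (L : ℕ) where
  V : Type
  E : Type
  [fintypeV : Fintype V]
  [fintypeE : Fintype E]
  src : E → V
  tgt : E → V
  color : E → Fin L

attribute [instance] ColoredNetwork.fintypeV ColoredNetwork.fintypeE

namespace ColoredNetwork

variable {L : ℕ}

/-- The vector whose `j`-th entry is the number of `j`-coloured arcs of `G`. -/
def arcCount (G : ColoredNetwork L) (j : Fin L) : ℕ :=
  Nat.card {e : G.E // G.color e = j}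

/-- The sum of the out-degree and the in-degree of a node. -/
def degree (G : ColoredNetwork L) (v : G.V) : ℕ :=
  Nat.card {e : G.E // G.src e = v} + Nat.card {e : G.E // G.tgt e = v}

/-- The underlying simple graph, in which distances between nodes are measured. -/
def underlying (G : ColoredNetwork L) : SimpleGraph G.V :=
  SimpleGraph.fromRel fun u v => ∃ e : G.E, G.src e = u ∧ G.tgt e = v

end ColoredNetwork

/-- A network with two distinct distinguished nodes `A` and `B`, used to replace an arc:
`A` takes the place of the beginning node of the arc and `B` that of its end node. -/
structure ReplacementNetwork (L : ℕ) extends ColoredNetwork L where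
  A : V
  B : V
  A_ne_B : A ≠ B

/-- Substitution rules: an `i`-coloured arc is replaced by `R i k` with probability `p i k`,
where `k` ranges over `q i` possibilities. -/
structure SubstitutionRules (L : ℕ) where
  q : Fin L → ℕ
  R : (i : Fin L) → Fin (q i) → ReplacementNetwork L
  p : (i : Fin L) → Fin (q i) → ℝ
  p_nonneg : ∀ i k, 0 ≤ p i k
  p_sum : ∀ i, ∑ k, p i k = 1

namespace SubstitutionRules

variable {L : ℕ} (S : SubstitutionRules L)

/-- The standing requirements on the rules. In each `R i k` that occurs, neither `A` nor `B` is
isolated; for each colour some `R i k` that occurs has `A` and `B` at distance greater than one,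
and some `R i k` that occurs has total degree greater than one at `A` or at `B`. -/
structure Admissible : Prop where
  degree_pos : ∀ i k, 0 < S.p i k →
    1 ≤ (S.R i k).degree (S.R i k).A ∧ 1 ≤ (S.R i k).degree (S.R i k).B
  exists_dist : ∀ i, ∃ k, 0 < S.p i k ∧
    1 < (S.R i k).underlying.edist (S.R i k).A (S.R i k).B
  exists_degree : ∀ i, ∃ k, 0 < S.p i k ∧
    (1 < (S.R i k).degree (S.R i k).A ∨ 1 < (S.R i k).degree (S.R i k).B)

/-- The matrix whose `(i, j)` entry is the expected number of `j`-coloured arcs in the network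
that replaces an `i`-coloured arc. -/
def arcMatrix : Matrix (Fin L) (Fin L) ℝ :=
  Matrix.of fun i j => ∑ k, S.p i k * ((S.R i k).arcCount j : ℝ)

open Classical in
/-- Replace every arc `e` of `G` by the network `S.R (G.color e) (κ e)`: the nodes are those
of `G` and, for each arc `e`, a fresh copy of each node other than `A` and `B` of the network
replacing `e`; the arcs are those of all the replacing networks. -/
def substitute (G : ColoredNetwork L) (κ : (e : G.E) → Fin (S.q (G.color e))) :
    ColoredNetwork L :=
  let Q : G.E → ReplacementNetwork L := fun e => S.R (G.color e) (κ e)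
  let place : (e : G.E) → (Q e).V → G.V ⊕ (Σ e : G.E, {v : (Q e).V // v ≠ (Q e).A ∧ v ≠ (Q e).B}) :=
    fun e v =>
      if hA : v = (Q e).A then Sum.inl (G.src e)
      else if hB : v = (Q e).B then Sum.inl (G.tgt e)
      else Sum.inr ⟨e, v, hA, hB⟩
  { V := G.V ⊕ (Σ e : G.E, {v : (Q e).V // v ≠ (Q e).A ∧ v ≠ (Q e).B})
    E := Σ e : G.E, (Q e).E
    src := fun x => place x.1 ((Q x.1).src x.2)
    tgt := fun x => place x.1 ((Q x.1).tgt x.2)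
    color := fun x => (Q x.1).color x.2 }

/-- The sequence `G⁰, G¹, G², …` obtained from an array of choices: at step `t`, the arc of `Gᵗ`
with number `n` (in a fixed enumeration of the arcs of `Gᵗ`) and colour `i` is replaced by
`R i (x t n i)`. -/
def network (G0 : ColoredNetwork L) (x : ℕ → ℕ → (i : Fin L) → Fin (S.q i)) :
    ℕ → ColoredNetwork L
  | 0 => G0
  | t + 1 => S.substitute (network G0 x t) fun e =>
      x t (Fintype.equivFin (network G0 x t).E e) ((network G0 x t).color e)

/-- The random choices: all of them are independent, and a choice for colour `i`
is equal to `k` with probability `p i k`. -/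
structure IsRandomChoice {Ω : Type*} [MeasurableSpace Ω] (μ : Measure Ω)
    (ξ : ℕ → ℕ → (i : Fin L) → Ω → Fin (S.q i)) : Prop where
  measurable : ∀ t n i, Measurable (ξ t n i)
  law : ∀ t n i k, μ {ω | ξ t n i ω = k} = ENNReal.ofReal (S.p i k)
  indep : iIndepFun (fun s : ℕ × ℕ × Fin L => ξ s.1 s.2.1 s.2.2) μ

/-- The random colour count vectors `χ(Gᵗ)`, with real entries, of the random network sequence
with initial network `G0`. -/
def randomArcCount {Ω : Type*} (G0 : ColoredNetwork L)
    (ξ : ℕ → ℕ → (i : Fin L) → Ω → Fin (S.q i)) (t : ℕ) (ω : Ω) (j : Fin L) : ℝ :=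
  ((S.network G0 (fun s n i => ξ s n i ω) t).arcCount j : ℝ)

end SubstitutionRules

/-- For sequences of vectors: the quotients `f / g` of corresponding entries converge to
a positive constant, the same for all entries. -/
def VectorAsymp {ι : Type*} (f g : ℕ → ι → ℝ) : Prop :=
  ∃ c : ℝ, 0 < c ∧ ∀ j, Tendsto (fun t => f t j / g t j) atTop (𝓝 c)

end

/-! The arc counts form a multitype branching process with mean matrix `S.arcMatrix`: conditionally
on the first `t` steps, the expectation of χ(Gᵗ⁺¹) is χ(Gᵗ)M, which also gives the formula for the
mean. Let `r` be the Perron eigenvalue of M, with positive right eigenvector `v` and positive left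
eigenvector `u`, normalized by u·v = 1. Each arc almost surely yields at least one arc, and at least
two with positive probability, so every row sum of M exceeds 1 and hence `r > 1`.

Convergence. The deviation of χ(Gᵗ⁺¹) from χ(Gᵗ)M is, given Gᵗ, a sum of independent bounded centred
terms, one per arc. Its conditional second moment is at most a constant times the number of arcs,
whose mean is of order rᵗ. The deviations divided by rᵗ⁺¹ are therefore summable in L¹ like
r^(-t/2), hence almost surely (`ae_summable_scaledDeviation`). So χ(Gᵗ)/rᵗ is an orbit of the
primitive matrix M/r with a summable perturbation, and such an orbit converges to a multiple W of
`u` (`tendsto_of_summable_perturbation`). The mean is an orbit without perturbation and converges to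
W'u with W' > 0.

Positivity of W (`ae_not_tendsto_zero`). Restarted from a network with N arcs at time `t`, the
martingale χ·v/rˢ starts at order N/rᵗ, while its later deviations have expected sum of order √N/rᵗ.
By Markov's inequality it dies out with conditional probability O(1/√N), uniformly in `t`. Since the
expectation of 2⁻ᴺ decays geometrically, N tends to infinity in probability, so W = 0 has
probability zero. The quotients then tend to W/W' for every color. -/

/-! ### Perron–Frobenius theory for primitive matrices -/

open Matrix in
/-- A primitive matrix has a positive eigenvalue with an entrywise positive right eigenvector. -/
theorem Matrix.IsPrimitive.exists_pos_eigenvector {ι : Type*} [Fintype ι] [DecidableEq ι]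
    [Nonempty ι] {M : Matrix ι ι ℝ} (hM : M.IsPrimitive) :
    ∃ r : ℝ, 0 < r ∧ ∃ v : ι → ℝ, (∀ i, 0 < v i) ∧ M *ᵥ v = r • v := by
  obtain ⟨hnn, k, hk, hpos⟩ := hM
  have hpow_pos : ∀ x : ι → ℝ, (∀ i, 0 ≤ x i) → (∃ i, 0 < x i) → ∀ i, 0 < (M ^ k *ᵥ x) i := by
    rintro x hx ⟨a, ha⟩ i
    exact Finset.sum_pos' (fun j _ => mul_nonneg (hpos i j).le (hx j))
      ⟨a, Finset.mem_univ _, mul_pos (hpos i a) ha⟩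
  set B : ℝ := ∑ i, ∑ j, M i j
  have hbound : ∀ (s : ℝ) (x : ι → ℝ), x ∈ stdSimplex ℝ ι → (∀ i, s * x i ≤ (M *ᵥ x) i) →
      s ≤ B := by
    rintro s x ⟨hx0, hx1⟩ hs
    have h1 : ∑ i, s * x i ≤ ∑ i, (M *ᵥ x) i := Finset.sum_le_sum fun i _ => hs i
    rw [← Finset.mul_sum, hx1, mul_one] at h1
    refine h1.trans (Finset.sum_le_sum fun i _ => Finset.sum_le_sum fun j _ => ?_)
    have : x j ≤ 1 := hx1 ▸ Finset.single_le_sum (fun j _ => hx0 j) (Finset.mem_univ j)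
    exact mul_le_of_le_one_right (hnn i j) this
  -- Collatz–Wielandt: the eigenvalue is the largest `s` for which some `x` in the simplex satisfies
  -- `s x ≤ M x`. The bound `B` makes the set of such pairs compact.
  set K : Set (ℝ × (ι → ℝ)) :=
    (Set.Icc 0 B ×ˢ stdSimplex ℝ ι) ∩ {z | ∀ i, z.1 * z.2 i ≤ (M *ᵥ z.2) i}
  have hKc : IsCompact K := by
    refine (isCompact_Icc.prod (isCompact_stdSimplex ℝ ι)).inter_right ?_
    rw [Set.ofPred_forall]
    refine isClosed_iInter fun i => isClosed_le (by fun_prop) ?_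
    simp only [Matrix.mulVec, dotProduct]
    fun_prop
  have hKn : K.Nonempty := by
    refine ⟨(0, Pi.single (Classical.arbitrary ι) 1), ⟨⟨⟨le_rfl, ?_⟩, single_mem_stdSimplex _ _⟩, ?_⟩⟩
    · exact Finset.sum_nonneg fun i _ => Finset.sum_nonneg fun j _ => hnn i j
    · intro i
      simp [hnn]
  obtain ⟨⟨r, x⟩, ⟨⟨⟨hr0, hrB⟩, hx⟩, hrx⟩, hmax⟩ :=
    hKc.exists_isMaxOn hKn continuous_fst.continuousOn
  simp only at hr0 hrB hx hrx
  have hx_pos : ∃ i, 0 < x i := by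
    by_contra! h
    have : ∑ i, x i ≤ 0 := Finset.sum_nonpos fun i _ => h i
    rw [hx.2] at this
    linarith
  -- If `y = M x - r x` were nonzero, `M ^ k` would make it strictly positive, so `z = M ^ k x`
  -- would satisfy `M z > r z` in every entry. After normalization, `r` could be raised by `ε`,
  -- against maximality.
  have heig : M *ᵥ x = r • x := by
    by_contra hne
    set y : ι → ℝ := M *ᵥ x - r • x with hy
    have hy0 : ∀ i, 0 ≤ y i := fun i => by simpa [hy] using hrx i
    have hy1 : ∃ i, 0 < y i := by
      by_contra! h
      exact hne (sub_eq_zero.1 (funext fun i => le_antisymm (h i) (hy0 i)))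
    set z : ι → ℝ := M ^ k *ᵥ x with hz
    have hz0 : ∀ i, 0 < z i := hpow_pos x hx.1 hx_pos
    have hzy : M ^ k *ᵥ y = M *ᵥ z - r • z := by
      rw [hy, hz, Matrix.mulVec_sub, Matrix.mulVec_smul, Matrix.mulVec_mulVec,
        Matrix.mulVec_mulVec, (Commute.self_pow M k).eq]
    have hgap : ∀ i, 0 < (M *ᵥ z) i - r * z i := fun i => by
      have := hpow_pos y hy0 hy1 i
      rw [hzy] at this
      simpa using this
    obtain ⟨a, -, ha⟩ := Finset.exists_min_image Finset.univ
      (fun i => ((M *ᵥ z) i - r * z i) / z i) Finset.univ_nonempty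
    set ε := ((M *ᵥ z) a - r * z a) / z a with hε
    have hε0 : 0 < ε := div_pos (hgap a) (hz0 a)
    have hzs : 0 < ∑ i, z i := Finset.sum_pos (fun i _ => hz0 i) Finset.univ_nonempty
    set w : ι → ℝ := (∑ i, z i)⁻¹ • z with hw
    have hws : w ∈ stdSimplex ℝ ι := by
      refine ⟨fun i => mul_nonneg (inv_nonneg.2 hzs.le) (hz0 i).le, ?_⟩
      simp only [hw, Pi.smul_apply, smul_eq_mul, ← Finset.mul_sum]
      exact inv_mul_cancel₀ hzs.ne'
    have hwr : ∀ i, (r + ε) * w i ≤ (M *ᵥ w) i := by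
      intro i
      have h1 := ha i (Finset.mem_univ i)
      rw [le_div_iff₀ (hz0 i)] at h1
      have h2 : (r + ε) * z i ≤ (M *ᵥ z) i := by linarith
      have := mul_le_mul_of_nonneg_left h2 (inv_nonneg.2 hzs.le)
      simp only [hw, Matrix.mulVec_smul, Pi.smul_apply, smul_eq_mul]
      linarith
    have hmem : (r + ε, w) ∈ K :=
      ⟨⟨⟨by linarith, hbound _ w hws hwr⟩, hws⟩, hwr⟩
    have := hmax hmem
    simp only [Set.mem_ofPred_eq] at this
    linarith
  have hpow : ∀ n : ℕ, M ^ n *ᵥ x = r ^ n • x := by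
    intro n
    induction n with
    | zero => simp
    | succ n ih =>
      rw [pow_succ, ← Matrix.mulVec_mulVec, heig, Matrix.mulVec_smul, ih, smul_smul, pow_succ,
        mul_comm]
  have hxk : ∀ i, 0 < r ^ k * x i := fun i => by
    have := hpow_pos x hx.1 hx_pos i
    rw [hpow] at this
    simpa using this
  have hr : 0 < r := by
    rcases hr0.eq_or_lt with h | h
    · have := hxk (Classical.arbitrary ι)
      rw [← h, zero_pow hk.ne', zero_mul] at this
      exact absurd this (lt_irrefl _)
    · exact h
  exact ⟨r, hr, x, fun i => pos_of_mul_pos_right (hxk i) (pow_pos hr k).le, heig⟩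

theorem Matrix.IsPrimitive.transpose {ι : Type*} [Fintype ι] [DecidableEq ι]
    {M : Matrix ι ι ℝ} (hM : M.IsPrimitive) : M.transpose.IsPrimitive := by
  obtain ⟨hnn, k, hk, hpos⟩ := hM
  refine ⟨fun i j => hnn j i, k, hk, fun i j => ?_⟩
  rw [← Matrix.transpose_pow]
  exact hpos j i

open Matrix in
/-- The Perron eigenvalue of a primitive matrix, with positive right and left eigenvectors. -/
theorem Matrix.IsPrimitive.exists_perron {ι : Type*} [Fintype ι] [DecidableEq ι]
    [Nonempty ι] {M : Matrix ι ι ℝ} (hM : M.IsPrimitive) :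
    ∃ r : ℝ, 0 < r ∧ ∃ u v : ι → ℝ, (∀ i, 0 < u i) ∧ (∀ i, 0 < v i) ∧
      M *ᵥ v = r • v ∧ u ᵥ* M = r • u ∧ u ⬝ᵥ v = 1 := by
  obtain ⟨r, hr, v, hv, hMv⟩ := hM.exists_pos_eigenvector
  obtain ⟨s, hs, u, hu, hMu⟩ := hM.transpose.exists_pos_eigenvector
  rw [Matrix.mulVec_transpose] at hMu
  have huv : 0 < u ⬝ᵥ v :=
    Finset.sum_pos (fun i _ => mul_pos (hu i) (hv i)) Finset.univ_nonempty
  have hrs : r = s := by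
    have h := Matrix.dotProduct_mulVec u M v
    rw [hMv, hMu, dotProduct_smul, smul_dotProduct, smul_eq_mul, smul_eq_mul] at h
    exact mul_right_cancel₀ huv.ne' h
  subst hrs
  refine ⟨r, hr, (u ⬝ᵥ v)⁻¹ • u, v, fun i => mul_pos (inv_pos.2 huv) (hu i), hv, hMv, ?_, ?_⟩
  · rw [Matrix.smul_vecMul, hMu, smul_comm]
  · rw [smul_dotProduct, smul_eq_mul, inv_mul_cancel₀ huv.ne']

/-! ### Perturbed iteration of a primitive matrix -/

/-- A nonnegative sequence which contracts along steps of length `k`, up to a summable error,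
is summable. -/
theorem summable_of_le_mul_add {a e : ℕ → ℝ} {q : ℝ} {k : ℕ} (ha : ∀ t, 0 ≤ a t)
    (he0 : ∀ t, 0 ≤ e t) (he : Summable e) (hq : q < 1)
    (h : ∀ t, a (t + k) ≤ q * a t + e t) :
    Summable a := by
  -- The partial sum over `n` terms is at most the first `k` terms plus the shifted sum, which is at
  -- most `q` times itself plus the errors; solving for it gives `c`.
  refine summable_of_sum_range_le (c := (∑ t ∈ Finset.range k, a t + ∑' t, e t) / (1 - q)) ha
    fun n => ?_
  rw [le_div_iff₀ (by linarith)]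
  have h1 : ∑ t ∈ Finset.range n, a t ≤ ∑ t ∈ Finset.range (k + n), a t :=
    Finset.sum_le_sum_of_subset_of_nonneg (by simp) fun i _ _ => ha i
  rw [Finset.sum_range_add] at h1
  have h2 : ∑ t ∈ Finset.range n, a (k + t) ≤
      q * ∑ t ∈ Finset.range n, a t + ∑ t ∈ Finset.range n, e t := by
    rw [Finset.mul_sum, ← Finset.sum_add_distrib]
    exact Finset.sum_le_sum fun t _ => by rw [add_comm k t]; exact h t
  have h3 := he.sum_le_tsum (Finset.range n) fun i _ => he0 i
  linarith

/-- The `ℓ¹` norm with weights `v`. -/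
noncomputable def weightedNorm {ι : Type*} [Fintype ι] (v x : ι → ℝ) : ℝ := ∑ j, |x j| * v j

section weightedNorm

open Matrix

variable {ι : Type*} [Fintype ι] {u v : ι → ℝ}

theorem weightedNorm_nonneg (hv : ∀ i, 0 < v i) (x : ι → ℝ) : 0 ≤ weightedNorm v x :=
  Finset.sum_nonneg fun i _ => mul_nonneg (abs_nonneg _) (hv i).le

theorem weightedNorm_add_le (hv : ∀ i, 0 < v i) (x y : ι → ℝ) :
    weightedNorm v (x + y) ≤ weightedNorm v x + weightedNorm v y := by
  simp only [weightedNorm, ← Finset.sum_add_distrib, ← add_mul]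
  exact Finset.sum_le_sum fun i _ => mul_le_mul_of_nonneg_right (abs_add_le _ _) (hv i).le

theorem abs_dotProduct_le_weightedNorm (hv : ∀ i, 0 < v i) (x : ι → ℝ) :
    |x ⬝ᵥ v| ≤ weightedNorm v x := by
  refine (Finset.abs_sum_le_sum_abs _ _).trans (Finset.sum_le_sum fun i _ => ?_)
  rw [abs_mul, abs_of_pos (hv i)]

/-- For nonnegative `T`, `|x T| ≤ |x| T` entrywise; pairing with the eigenvector `v` gives the
factor. This is why the weights are `v`. -/
theorem weightedNorm_vecMul_le (hv : ∀ i, 0 < v i) {T : Matrix ι ι ℝ} (hT : ∀ i j, 0 ≤ T i j)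
    {c : ℝ} (hTv : T *ᵥ v = c • v) (x : ι → ℝ) :
    weightedNorm v (x ᵥ* T) ≤ c * weightedNorm v x := by
  calc weightedNorm v (x ᵥ* T) ≤ ∑ j, ∑ i, |x i| * (T i j * v j) := by
        refine Finset.sum_le_sum fun j _ => ?_
        simp only [Matrix.vecMul, dotProduct, ← mul_assoc, ← Finset.sum_mul]
        refine mul_le_mul_of_nonneg_right ((Finset.abs_sum_le_sum_abs _ _).trans ?_) (hv j).le
        exact Finset.sum_le_sum fun i _ => by rw [abs_mul, abs_of_nonneg (hT i j)]
    _ = ∑ i, |x i| * (T *ᵥ v) i := by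
        rw [Finset.sum_comm]
        simp only [Matrix.mulVec, dotProduct, Finset.mul_sum]
    _ = c * weightedNorm v x := by
        rw [hTv, weightedNorm, Finset.mul_sum]
        refine Finset.sum_congr rfl fun i _ => ?_
        simp only [Pi.smul_apply, smul_eq_mul]
        ring

theorem mulVec_pow_of_fixed [DecidableEq ι] {T : Matrix ι ι ℝ} (hTv : T *ᵥ v = v) (n : ℕ) :
    T ^ n *ᵥ v = v := by
  induction n with
  | zero => simp
  | succ n ih => rw [pow_succ, ← Matrix.mulVec_mulVec, hTv, ih]

/-- A positive power of a matrix that fixes `v` is a contraction on the vectors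
orthogonal to `v`. -/
theorem exists_weightedNorm_contraction [Nonempty ι] (hu : ∀ i, 0 < u i)
    (hv : ∀ i, 0 < v i) (huv : u ⬝ᵥ v = 1) {T : Matrix ι ι ℝ} (hT : ∀ i j, 0 < T i j)
    (hTv : T *ᵥ v = v) :
    ∃ q : ℝ, q < 1 ∧ ∀ x : ι → ℝ, x ⬝ᵥ v = 0 →
      weightedNorm v (x ᵥ* T) ≤ q * weightedNorm v x := by
  -- A Doeblin minorization: `ε` is the largest number with `T ≥ ε v uᵀ` entrywise. The rank-one
  -- part annihilates every `x` orthogonal to `v`, and the nonnegative remainder has `v` as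
  -- eigenvector for `1 - ε`.
  obtain ⟨⟨a, b⟩, -, hab⟩ := Finset.exists_min_image (Finset.univ : Finset (ι × ι))
    (fun p => T p.1 p.2 / (v p.1 * u p.2)) Finset.univ_nonempty
  set ε := T a b / (v a * u b) with hε
  have hε0 : 0 < ε := div_pos (hT a b) (mul_pos (hv a) (hu b))
  have hle : ∀ i j, 0 ≤ (T - ε • Matrix.vecMulVec v u) i j := by
    intro i j
    have h1 : ε ≤ T i j / (v i * u j) := hab (i, j) (Finset.mem_univ _)
    rw [le_div_iff₀ (mul_pos (hv i) (hu j))] at h1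
    simp only [Matrix.sub_apply, Matrix.smul_apply, Matrix.vecMulVec_apply, smul_eq_mul]
    linarith
  refine ⟨1 - ε, by linarith, fun x hx => ?_⟩
  have hfix : (T - ε • Matrix.vecMulVec v u) *ᵥ v = (1 - ε) • v := by
    rw [Matrix.sub_mulVec, Matrix.smul_mulVec, Matrix.vecMulVec_mulVec, huv, hTv]
    ext i
    simp
    ring
  have hx' : x ᵥ* T = x ᵥ* (T - ε • Matrix.vecMulVec v u) := by
    rw [Matrix.vecMul_sub, Matrix.vecMul_smul, Matrix.vecMul_vecMulVec, hx]
    simp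
  rw [hx']
  exact weightedNorm_vecMul_le hv hle hfix x

/-- Iterating a primitive matrix with Perron eigenvalue one, with a summable perturbation,
yields a sequence that converges to a multiple of the left Perron eigenvector. -/
theorem tendsto_of_summable_perturbation [DecidableEq ι] [Nonempty ι] (hu : ∀ i, 0 < u i)
    (hv : ∀ i, 0 < v i) (huv : u ⬝ᵥ v = 1) {T : Matrix ι ι ℝ} (hT : T.IsPrimitive)
    (hTv : T *ᵥ v = v) (huT : u ᵥ* T = u) {Y : ℕ → ι → ℝ}
    (hd : Summable fun t => weightedNorm v (Y (t + 1) - Y t ᵥ* T)) :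
    ∃ W : ℝ, Tendsto (fun t => Y t ⬝ᵥ v) atTop (𝓝 W) ∧
      ∀ j, Tendsto (fun t => Y t j) atTop (𝓝 (W * u j)) := by
  obtain ⟨hnn, k, hk, hpos⟩ := hT
  obtain ⟨q, hq1, hq⟩ :=
    exists_weightedNorm_contraction hu hv huv hpos (mulVec_pow_of_fixed hTv k)
  set d : ℕ → ι → ℝ := fun t => Y (t + 1) - Y t ᵥ* T with hd_def
  have hYs : ∀ t, Y (t + 1) = Y t ᵥ* T + d t := fun t => by simp [hd_def]
  have hW : ∀ t, Y (t + 1) ⬝ᵥ v = Y t ⬝ᵥ v + d t ⬝ᵥ v := fun t => by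
    rw [hYs, add_dotProduct, ← Matrix.dotProduct_mulVec, hTv]
  obtain ⟨W, hWlim⟩ : ∃ W, Tendsto (fun t => Y t ⬝ᵥ v) atTop (𝓝 W) := by
    have hs : Summable fun t => d t ⬝ᵥ v :=
      Summable.of_norm_bounded hd fun t => abs_dotProduct_le_weightedNorm hv _
    refine ⟨Y 0 ⬝ᵥ v + ∑' t, d t ⬝ᵥ v, ?_⟩
    have hsum : ∀ t, Y t ⬝ᵥ v = Y 0 ⬝ᵥ v + ∑ s ∈ Finset.range t, d s ⬝ᵥ v := by
      intro t
      induction t with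
      | zero => simp
      | succ t ih => rw [hW, ih, Finset.sum_range_succ, add_assoc]
    exact (hs.hasSum.tendsto_sum_nat.const_add _).congr fun t => (hsum t).symm
  -- Removing the component along `u` leaves a vector orthogonal to `v`, where `T ^ k` contracts. It
  -- obeys the same recursion, with the perturbation projected in the same way.
  set z : ℕ → ι → ℝ := fun t => Y t - (Y t ⬝ᵥ v) • u with hz
  have hzv : ∀ t, z t ⬝ᵥ v = 0 := fun t => by
    simp only [hz, sub_dotProduct, smul_dotProduct, huv, smul_eq_mul, mul_one, sub_self]
  have hzs : ∀ t, z (t + 1) = z t ᵥ* T + (d t + (-(d t ⬝ᵥ v)) • u) := fun t => by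
    change Y (t + 1) - (Y (t + 1) ⬝ᵥ v) • u = (Y t - (Y t ⬝ᵥ v) • u) ᵥ* T + _
    rw [hW, hYs, Matrix.sub_vecMul, Matrix.smul_vecMul, huT]
    ext i
    simp
    ring
  have hu_norm : weightedNorm v u = 1 := by
    rw [← huv]
    exact Finset.sum_congr rfl fun i _ => by rw [abs_of_pos (hu i)]
  have hd2 : ∀ t, weightedNorm v (d t + (-(d t ⬝ᵥ v)) • u) ≤ 2 * weightedNorm v (d t) := by
    intro t
    refine (weightedNorm_add_le hv _ _).trans ?_
    have : weightedNorm v ((-(d t ⬝ᵥ v)) • u) = |d t ⬝ᵥ v| * weightedNorm v u := by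
      simp only [weightedNorm, Finset.mul_sum, Pi.smul_apply, smul_eq_mul, abs_mul, abs_neg,
        mul_assoc]
    rw [this, hu_norm]
    linarith [abs_dotProduct_le_weightedNorm hv (d t)]
  -- `T` itself does not increase the weighted norm, so over several steps the perturbations merely
  -- add up.
  have hiter : ∀ m t, weightedNorm v (z (t + m) - z t ᵥ* T ^ m) ≤
      ∑ s ∈ Finset.range m, 2 * weightedNorm v (d (t + s)) := by
    intro m t
    induction m with
    | zero => simp [weightedNorm]
    | succ m ih =>
      have : z (t + (m + 1)) - z t ᵥ* T ^ (m + 1) =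
          (z (t + m) - z t ᵥ* T ^ m) ᵥ* T + (d (t + m) + (-(d (t + m) ⬝ᵥ v)) • u) := by
        rw [← add_assoc, hzs, Matrix.sub_vecMul _ (z (t + m)), Matrix.vecMul_vecMul, ← pow_succ]
        abel
      rw [this, Finset.sum_range_succ]
      refine (weightedNorm_add_le hv _ _).trans (add_le_add (le_trans ?_ ih) (hd2 _))
      simpa using weightedNorm_vecMul_le hv hnn (c := 1) (by simpa using hTv)
        (z (t + m) - z t ᵥ* T ^ m)
  have hzsum : Summable fun t => weightedNorm v (z t) := by
    refine summable_of_le_mul_add (k := k)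
      (e := fun t => ∑ s ∈ Finset.range k, 2 * weightedNorm v (d (t + s)))
      (fun t => weightedNorm_nonneg hv _)
      (fun t => Finset.sum_nonneg fun s _ => mul_nonneg zero_le_two (weightedNorm_nonneg hv _))
      (summable_sum fun s _ => ((summable_nat_add_iff s).2 hd).mul_left 2) hq1 fun t => ?_
    have h1 : z (t + k) = z t ᵥ* T ^ k + (z (t + k) - z t ᵥ* T ^ k) := by abel
    rw [h1]
    exact (weightedNorm_add_le hv _ _).trans (add_le_add (hq _ (hzv t)) (hiter k t))
  refine ⟨W, hWlim, fun j => ?_⟩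
  have hzj : Tendsto (fun t => z t j) atTop (𝓝 0) := by
    refine squeeze_zero_norm (a := fun t => weightedNorm v (z t) * (v j)⁻¹) (fun t => ?_) ?_
    · rw [← div_eq_mul_inv, le_div_iff₀ (hv j), Real.norm_eq_abs]
      exact Finset.single_le_sum (f := fun i => |z t i| * v i)
        (fun i _ => mul_nonneg (abs_nonneg _) (hv i).le) (Finset.mem_univ j)
    · simpa using hzsum.tendsto_atTop_zero.mul_const (v j)⁻¹
  have := hzj.add (hWlim.mul_const (u j))
  simpa [hz] using this

end weightedNorm

/-! ### Arc counts under substitution -/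

namespace ColoredNetwork

variable {L : ℕ}

theorem sum_arcCount_mul (G : ColoredNetwork L) (f : Fin L → ℝ) :
    ∑ j, (G.arcCount j : ℝ) * f j = ∑ e, f (G.color e) := by
  rw [← Finset.sum_fiberwise_of_maps_to (s := Finset.univ) (t := Finset.univ) (g := G.color)
    (fun _ _ => Finset.mem_univ _)]
  refine Finset.sum_congr rfl fun j _ => ?_
  rw [Finset.sum_congr rfl fun e he => by rw [(Finset.mem_filter.1 he).2], Finset.sum_const,
    nsmul_eq_mul, arcCount, Nat.card_eq_fintype_card, Fintype.card_subtype]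

theorem arcCount_le_card (G : ColoredNetwork L) (j : Fin L) :
    G.arcCount j ≤ Fintype.card G.E := by
  rw [arcCount, Nat.card_eq_fintype_card]
  exact Fintype.card_subtype_le _

theorem sum_arcCount (G : ColoredNetwork L) : ∑ j, G.arcCount j = Fintype.card G.E := by
  have := G.sum_arcCount_mul fun _ => 1
  simp only [mul_one, Finset.sum_const, Finset.card_univ, nsmul_eq_mul] at this
  exact_mod_cast this

end ColoredNetwork

namespace ReplacementNetwork

variable {L : ℕ} (R : ReplacementNetwork L)

theorem exists_arc_at {G : ColoredNetwork L} {v : G.V} (h : 1 ≤ G.degree v) :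
    ∃ e, G.src e = v ∨ G.tgt e = v := by
  by_contra! hne
  have h1 : IsEmpty {e : G.E // G.src e = v} := ⟨fun e => (hne e.1).1 e.2⟩
  have h2 : IsEmpty {e : G.E // G.tgt e = v} := ⟨fun e => (hne e.1).2 e.2⟩
  simp [ColoredNetwork.degree] at h

theorem one_le_card_arcs (hA : 1 ≤ R.degree R.A) : 1 ≤ Fintype.card R.E := by
  obtain ⟨e, -⟩ := exists_arc_at hA
  exact Fintype.card_pos_iff.2 ⟨e⟩

/-- Neither `A` nor `B` is isolated; if a single arc met both of these distinct nodes, it would join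
them and put them at distance one. -/
theorem two_le_card_arcs (hA : 1 ≤ R.degree R.A) (hB : 1 ≤ R.degree R.B)
    (hd : 1 < R.underlying.edist R.A R.B) : 2 ≤ Fintype.card R.E := by
  obtain ⟨a, ha⟩ := exists_arc_at hA
  obtain ⟨b, hb⟩ := exists_arc_at hB
  refine Fintype.one_lt_card_iff.2 ⟨a, b, ?_⟩
  rintro rfl
  have hne := R.A_ne_B
  refine hd.not_ge (SimpleGraph.edist_le_one_iff_adj_or_eq.2 (Or.inl ?_))
  rw [ColoredNetwork.underlying, SimpleGraph.fromRel_adj]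
  refine ⟨hne, ?_⟩
  rcases ha with ha | ha <;> rcases hb with hb | hb
  · exact absurd (ha.symm.trans hb) hne
  · exact Or.inl ⟨a, ha, hb⟩
  · exact Or.inr ⟨a, hb, ha⟩
  · exact absurd (ha.symm.trans hb) hne

end ReplacementNetwork

namespace SubstitutionRules

variable {L : ℕ} (S : SubstitutionRules L)

theorem arcCount_substitute (G : ColoredNetwork L)
    (κ : (e : G.E) → Fin (S.q (G.color e))) (j : Fin L) :
    (S.substitute G κ).arcCount j = ∑ e, (S.R (G.color e) (κ e)).arcCount j := by
  have h : {x : (S.substitute G κ).E // (S.substitute G κ).color x = j} ≃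
      Σ e : G.E, {x : (S.R (G.color e) (κ e)).E // (S.R (G.color e) (κ e)).color x = j} :=
    { toFun := fun x => ⟨x.1.1, x.1.2, x.2⟩
      invFun := fun x => ⟨⟨x.1, x.2.1⟩, x.2.2⟩
      left_inv := fun _ => rfl
      right_inv := fun _ => rfl }
  rw [ColoredNetwork.arcCount, Nat.card_congr h, Nat.card_sigma]
  rfl

theorem card_substitute (G : ColoredNetwork L) (κ : (e : G.E) → Fin (S.q (G.color e))) :
    Fintype.card (S.substitute G κ).E = ∑ e, Fintype.card (S.R (G.color e) (κ e)).E := by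
  simp only [← ColoredNetwork.sum_arcCount, arcCount_substitute]
  exact Finset.sum_comm

/-- The largest number of arcs in a replacing network. -/
def maxArcs : ℕ := ∑ i, ∑ k, Fintype.card (S.R i k).E

theorem card_le_maxArcs (i : Fin L) (k : Fin (S.q i)) :
    Fintype.card (S.R i k).E ≤ S.maxArcs :=
  (Finset.single_le_sum (f := fun k => Fintype.card (S.R i k).E) (fun _ _ => Nat.zero_le _)
    (Finset.mem_univ k)).trans
  (Finset.single_le_sum (f := fun i => ∑ k, Fintype.card (S.R i k).E) (fun _ _ => Nat.zero_le _)
    (Finset.mem_univ i))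

/-- Finiteness lets conditioning on the network at time `t` be done by finite sums over its values,
and makes every function of it bounded. -/
theorem finite_range_network (G0 : ColoredNetwork L) (t : ℕ) :
    (Set.range fun x => S.network G0 x t).Finite := by
  induction t with
  | zero => exact (Set.finite_singleton G0).subset (by rintro _ ⟨x, rfl⟩; rfl)
  | succ t ih =>
    refine (ih.biUnion fun G _ => Set.finite_range fun κ => S.substitute G κ).subset ?_
    rintro _ ⟨x, rfl⟩
    exact Set.mem_biUnion (Set.mem_range_self x) ⟨_, rfl⟩

variable {S}

theorem Admissible.one_le_card (hS : S.Admissible) {i : Fin L} {k : Fin (S.q i)}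
    (hk : 0 < S.p i k) : 1 ≤ Fintype.card (S.R i k).E :=
  (S.R i k).one_le_card_arcs (hS.degree_pos i k hk).1

theorem Admissible.exists_two_le_card (hS : S.Admissible) (i : Fin L) :
    ∃ k, 0 < S.p i k ∧ 2 ≤ Fintype.card (S.R i k).E := by
  obtain ⟨k, hk, hd⟩ := hS.exists_dist i
  exact ⟨k, hk, (S.R i k).two_le_card_arcs (hS.degree_pos i k hk).1 (hS.degree_pos i k hk).2 hd⟩

variable (S) in
theorem sum_arcMatrix (i : Fin L) :
    ∑ j, S.arcMatrix i j = ∑ k, S.p i k * (Fintype.card (S.R i k).E : ℝ) := by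
  simp only [arcMatrix, Matrix.of_apply]
  rw [Finset.sum_comm]
  simp only [← Finset.mul_sum, ← ColoredNetwork.sum_arcCount, Nat.cast_sum]

theorem Admissible.one_lt_sum_arcMatrix (hS : S.Admissible) (i : Fin L) :
    1 < ∑ j, S.arcMatrix i j := by
  rw [S.sum_arcMatrix, ← S.p_sum i]
  obtain ⟨k, hk, hk2⟩ := hS.exists_two_le_card i
  have hk2 : (2 : ℝ) ≤ Fintype.card (S.R i k).E := by exact_mod_cast hk2
  refine Finset.sum_lt_sum (fun l _ => ?_) ⟨k, Finset.mem_univ k, by nlinarith⟩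
  rcases (S.p_nonneg i l).eq_or_lt with h | h
  · simp [← h]
  · have : (1 : ℝ) ≤ Fintype.card (S.R i l).E := by exact_mod_cast hS.one_le_card h
    nlinarith

open Matrix in
-- Summing the entries of `u M = r u` shows that `r` is an average of the row sums of M with weights
-- `u`, and every row sum exceeds 1.
theorem Admissible.one_lt_of_left_eigenvector (hS : S.Admissible) [Nonempty (Fin L)]
    {u : Fin L → ℝ} (hu : ∀ i, 0 < u i) {r : ℝ} (h : u ᵥ* S.arcMatrix = r • u) : 1 < r := by
  have h1 : ∑ i, u i * ∑ j, S.arcMatrix i j = r * ∑ j, u j := by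
    simp only [Finset.mul_sum]
    rw [Finset.sum_comm]
    exact Finset.sum_congr rfl fun j _ => congrFun h j
  have h2 : ∑ i, u i < ∑ i, u i * ∑ j, S.arcMatrix i j :=
    Finset.sum_lt_sum_of_nonempty Finset.univ_nonempty fun i _ =>
      lt_mul_of_one_lt_right (hu i) (hS.one_lt_sum_arcMatrix i)
  have h3 : 0 < ∑ i, u i := Finset.sum_pos (fun i _ => hu i) Finset.univ_nonempty
  rw [h1] at h2
  exact (lt_mul_iff_one_lt_left h3).1 h2

/-! ### The filtration of past choices -/

section random

variable {Ω : Type*}  {ξ : ℕ → ℕ → (i : Fin L) → Ω → Fin (S.q i)} (G0 : ColoredNetwork L)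

/-- The random network after `t` steps. -/
noncomputable def randomNetwork (ξ : ℕ → ℕ → (i : Fin L) → Ω → Fin (S.q i)) (t : ℕ) (ω : Ω) :
    ColoredNetwork L :=
  S.network G0 (fun s n i => ξ s n i ω) t

/-- The σ-algebra generated by the choices at the first `t` steps. -/
@[reducible]
def past (ξ : ℕ → ℕ → (i : Fin L) → Ω → Fin (S.q i)) (t : ℕ) : MeasurableSpace Ω :=
  ⨆ s ∈ {s : ℕ × ℕ × Fin L | s.1 < t},
    MeasurableSpace.comap (ξ s.1 s.2.1 s.2.2) inferInstance

theorem past_mono {s t : ℕ} (h : s ≤ t) : past ξ s ≤ past ξ t :=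
  biSup_mono fun _ hs => lt_of_lt_of_le hs h

theorem measurableSet_past {s t : ℕ} (h : s < t) (n : ℕ) (i : Fin L) (k : Fin (S.q i)) :
    MeasurableSet[past ξ t] {ω | ξ s n i ω = k} :=
  (le_biSup (fun s : ℕ × ℕ × Fin L => MeasurableSpace.comap (ξ s.1 s.2.1 s.2.2) inferInstance)
    (show (s, n, i) ∈ {s : ℕ × ℕ × Fin L | s.1 < t} from h)) _
    ⟨{k}, MeasurableSet.of_discrete, rfl⟩

/-- With the current network fixed as `G`, the arcs to be replaced no longer depend on `ω`. -/
theorem randomNetwork_succ_of_eq {t : ℕ} {ω : Ω} {G : ColoredNetwork L}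
    (h : randomNetwork G0 ξ t ω = G) :
    randomNetwork G0 ξ (t + 1) ω =
      S.substitute G fun e => ξ t (Fintype.equivFin G.E e) (G.color e) ω := by
  subst h
  rfl

theorem measurableSet_randomNetwork_eq (t : ℕ) (G : ColoredNetwork L) :
    MeasurableSet[past ξ t] {ω | randomNetwork G0 ξ t ω = G} := by
  induction t generalizing G with
  | zero => exact MeasurableSet.const (G0 = G)
  | succ t ih =>
    -- The next network is determined by the present one and the choices for its finitely many arcs;
    -- the event is split over all these possibilities.
    have h : {ω | randomNetwork G0 ξ (t + 1) ω = G} =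
        ⋃ H ∈ Set.range fun x => S.network G0 x t,
          ⋃ κ ∈ {κ : (e : H.E) → Fin (S.q (H.color e)) | S.substitute H κ = G},
            {ω | randomNetwork G0 ξ t ω = H} ∩
              ⋂ e : H.E, {ω | ξ t (Fintype.equivFin H.E e) (H.color e) ω = κ e} := by
      ext ω
      simp only [Set.mem_iUnion, Set.mem_inter_iff, Set.mem_iInter, Set.mem_ofPred_eq, exists_prop]
      constructor
      · intro hG
        exact ⟨_, ⟨_, rfl⟩, _, (randomNetwork_succ_of_eq G0 rfl).symm.trans hG, rfl, fun e => rfl⟩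
      · rintro ⟨H, -, κ, hκ, hH, hξ⟩
        rw [randomNetwork_succ_of_eq G0 hH, ← hκ]
        congr 1
        exact funext hξ
    rw [h]
    refine MeasurableSet.biUnion (S.finite_range_network G0 t).countable fun H _ =>
      MeasurableSet.biUnion (Set.to_countable _) fun κ _ =>
        (past_mono t.le_succ _ (ih H)).inter (MeasurableSet.iInter fun e =>
          measurableSet_past t.lt_succ_self _ _ _)

end random

end SubstitutionRules

/-! ### Independence of the choices and first moments -/

namespace SubstitutionRules

variable {L : ℕ} {S : SubstitutionRules L} {Ω : Type*} [mΩ : MeasurableSpace Ω] {μ : Measure Ω}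
  [IsProbabilityMeasure μ] {ξ : ℕ → ℕ → (i : Fin L) → Ω → Fin (S.q i)} (G0 : ColoredNetwork L)

namespace IsRandomChoice

omit [IsProbabilityMeasure μ] in
theorem past_le (hξ : S.IsRandomChoice μ ξ) (t : ℕ) : past ξ t ≤ mΩ :=
  iSup₂_le fun s _ => (hξ.measurable s.1 s.2.1 s.2.2).comap_le

omit [IsProbabilityMeasure μ] in
theorem measureReal_choice (hξ : S.IsRandomChoice μ ξ) (t n : ℕ) (i : Fin L) (k : Fin (S.q i)) :
    μ.real {ω | ξ t n i ω = k} = S.p i k := by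
  rw [measureReal_def, hξ.law, ENNReal.toReal_ofReal (S.p_nonneg i k)]

theorem integral_choice (hξ : S.IsRandomChoice μ ξ) (t n : ℕ) (i : Fin L)
    (f : Fin (S.q i) → ℝ) : ∫ ω, f (ξ t n i ω) ∂μ = ∑ k, S.p i k * f k := by
  have hm := hξ.measurable t n i
  have : IsProbabilityMeasure (μ.map (ξ t n i)) := Measure.isProbabilityMeasure_map hm.aemeasurable
  rw [← integral_map hm.aemeasurable (Measurable.of_discrete (f := f)).aestronglyMeasurable,
    integral_fintype .of_finite]
  refine Finset.sum_congr rfl fun k _ => ?_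
  rw [map_measureReal_apply hm (MeasurableSet.singleton k), smul_eq_mul]
  exact congrArg (· * f k) (hξ.measureReal_choice t n i k)

omit [IsProbabilityMeasure μ] in
theorem indep_past (hξ : S.IsRandomChoice μ ξ) (t : ℕ) {T : Set (ℕ × ℕ × Fin L)}
    (hT : ∀ s ∈ T, t ≤ s.1) :
    Indep (past ξ t)
      (⨆ s ∈ T, MeasurableSpace.comap (ξ s.1 s.2.1 s.2.2) inferInstance) μ :=
  indep_iSup_of_disjoint
    (m := fun s : ℕ × ℕ × Fin L => MeasurableSpace.comap (ξ s.1 s.2.1 s.2.2) inferInstance)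
    (fun s => (hξ.measurable s.1 s.2.1 s.2.2).comap_le)
    ((iIndepFun_iff_iIndep _ _ _).1 hξ.indep)
    (Set.disjoint_left.2 fun s hs hs' => absurd (hT s hs') (not_le.2 hs))

theorem setIntegral_choice (hξ : S.IsRandomChoice μ ξ) {t : ℕ} {A : Set Ω}
    (hA : MeasurableSet[past ξ t] A) (n : ℕ) (i : Fin L) (f : Fin (S.q i) → ℝ) :
    ∫ ω in A, f (ξ t n i ω) ∂μ = μ.real A * ∑ k, S.p i k * f k := by
  have hind : Indep (past ξ t) (MeasurableSpace.comap (ξ t n i) inferInstance) μ :=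
    indep_of_indep_of_le_right (hξ.indep_past t (T := {(t, n, i)}) (by simp)) (by simp)
  rw [Indep.setIntegral_eq_mul (hξ.past_le t) hind (hξ.measurable t n i).aemeasurable hA
    (Measurable.of_discrete (f := f)).aestronglyMeasurable, hξ.integral_choice]

theorem setIntegral_choice_mul_choice (hξ : S.IsRandomChoice μ ξ) {t : ℕ} {A : Set Ω}
    (hA : MeasurableSet[past ξ t] A) {n n' : ℕ} (hn : n ≠ n') (i i' : Fin L)
    (f : Fin (S.q i) → ℝ) (g : Fin (S.q i') → ℝ) :
    ∫ ω in A, f (ξ t n i ω) * g (ξ t n' i' ω) ∂μ =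
      μ.real A * ((∑ k, S.p i k * f k) * ∑ k, S.p i' k * g k) := by
  have hm := hξ.measurable t n i
  have hm' := hξ.measurable t n' i'
  have hind : Indep (past ξ t)
      (MeasurableSpace.comap (fun ω => (ξ t n i ω, ξ t n' i' ω)) inferInstance) μ := by
    refine indep_of_indep_of_le_right (hξ.indep_past t (T := {(t, n, i), (t, n', i')}) (by simp)) ?_
    rw [iSup_pair]
    exact (MeasurableSpace.comap_prodMk _ _).le
  rw [Indep.setIntegral_eq_mul (f := fun z => f z.1 * g z.2) (hξ.past_le t) hind
    (hm.prodMk hm').aemeasurable hA (Measurable.of_discrete).aestronglyMeasurable,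
    ← hξ.integral_choice t n, ← hξ.integral_choice t n']
  congr 1
  have h : IndepFun (ξ t n i) (ξ t n' i') μ :=
    hξ.indep.indepFun (i := (t, n, i)) (j := (t, n', i')) (by simp [hn])
  exact h.integral_fun_comp_mul_comp hm.aemeasurable hm'.aemeasurable
    (Measurable.of_discrete (f := f)).aestronglyMeasurable
    (Measurable.of_discrete (f := g)).aestronglyMeasurable

omit [IsProbabilityMeasure μ] in
-- Admissibility restricts only the networks of positive probability; this discards the others on a
-- null set.
theorem ae_choice_pos (hξ : S.IsRandomChoice μ ξ) : ∀ᵐ ω ∂μ, ∀ t n i, 0 < S.p i (ξ t n i ω) := by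
  refine ae_all_iff.2 fun t => ae_all_iff.2 fun n => ae_all_iff.2 fun i => ?_
  have h : ∀ k, ∀ᵐ ω ∂μ, ξ t n i ω = k → 0 < S.p i k := by
    intro k
    rcases (S.p_nonneg i k).eq_or_lt with hk | hk
    · have : μ {ω | ξ t n i ω = k} = 0 := by rw [hξ.law, ← hk, ENNReal.ofReal_zero]
      filter_upwards [measure_eq_zero_iff_ae_notMem.1 this] with ω hω h
      exact absurd h hω
    · exact ae_of_all _ fun _ _ => hk
  filter_upwards [ae_all_iff.2 h] with ω hω using hω _ rfl

omit [IsProbabilityMeasure μ] in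
theorem measurableSet_randomNetwork_eq (hξ : S.IsRandomChoice μ ξ) (t : ℕ)
    (G : ColoredNetwork L) : MeasurableSet {ω | randomNetwork G0 ξ t ω = G} :=
  hξ.past_le t _ (SubstitutionRules.measurableSet_randomNetwork_eq G0 t G)

end IsRandomChoice

omit mΩ in
theorem finite_range_randomNetwork (t : ℕ) : (Set.range (randomNetwork G0 ξ t)).Finite :=
  (S.finite_range_network G0 t).subset (by rintro _ ⟨ω, rfl⟩; exact ⟨_, rfl⟩)

namespace IsRandomChoice

omit [IsProbabilityMeasure μ] in
theorem measurable_comp_randomNetwork (hξ : S.IsRandomChoice μ ξ) (t : ℕ)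
    (f : ColoredNetwork L → ℝ) : Measurable fun ω => f (randomNetwork G0 ξ t ω) := by
  intro B _
  have : (fun ω => f (randomNetwork G0 ξ t ω)) ⁻¹' B =
      ⋃ G ∈ Set.range (randomNetwork G0 ξ t) ∩ f ⁻¹' B, {ω | randomNetwork G0 ξ t ω = G} := by
    ext ω
    simp
  rw [this]
  exact MeasurableSet.biUnion ((finite_range_randomNetwork G0 t).subset
    Set.inter_subset_left).countable fun G _ => hξ.measurableSet_randomNetwork_eq G0 t G

theorem integrable_comp_randomNetwork (hξ : S.IsRandomChoice μ ξ) (t : ℕ)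
    (f : ColoredNetwork L → ℝ) : Integrable (fun ω => f (randomNetwork G0 ξ t ω)) μ := by
  obtain ⟨C, hC⟩ := ((finite_range_randomNetwork (ξ := ξ) G0 t).image fun G => ‖f G‖).bddAbove
  exact .of_bound (hξ.measurable_comp_randomNetwork G0 t f).aestronglyMeasurable C
    (ae_of_all _ fun ω => hC ⟨_, ⟨ω, rfl⟩, rfl⟩)

theorem integrable_comp_choice (hξ : S.IsRandomChoice μ ξ) (t n : ℕ) (i : Fin L)
    (f : Fin (S.q i) → ℝ) : Integrable (fun ω => f (ξ t n i ω)) μ := by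
  obtain ⟨C, hC⟩ := (Set.finite_range fun k => ‖f k‖).bddAbove
  exact .of_bound ((Measurable.of_discrete (f := f)).comp
    (hξ.measurable t n i)).aestronglyMeasurable C (ae_of_all _ fun ω => hC ⟨_, rfl⟩)

omit [IsProbabilityMeasure μ] in
theorem setIntegral_eq_sum_randomNetwork (hξ : S.IsRandomChoice μ ξ) (t : ℕ) {F : Ω → ℝ}
    (hF : Integrable F μ) {A : Set Ω} (hA : MeasurableSet A) :
    ∫ ω in A, F ω ∂μ = ∑ G ∈ (finite_range_randomNetwork (ξ := ξ) G0 t).toFinset,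
      ∫ ω in A ∩ {ω | randomNetwork G0 ξ t ω = G}, F ω ∂μ := by
  rw [← integral_biUnion_finset _
    (fun G _ => hA.inter (hξ.measurableSet_randomNetwork_eq G0 t G)) ?_
    (fun G _ => hF.integrableOn)]
  · congr 2
    ext ω
    simp
  · intro G _ H _ hGH
    refine Set.disjoint_left.2 fun ω hG hH => hGH ?_
    exact hG.2.symm.trans hH.2

omit [IsProbabilityMeasure μ] in
/-- To compare integrals over an event, it suffices to do so on the parts where the network
after `t` steps is constant. -/
theorem setIntegral_mono_of_randomNetwork (hξ : S.IsRandomChoice μ ξ) (t : ℕ) {F H : Ω → ℝ}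
    (hF : Integrable F μ) (hH : Integrable H μ) {A : Set Ω} (hA : MeasurableSet[past ξ t] A)
    (h : ∀ (G : ColoredNetwork L) (B : Set Ω), MeasurableSet[past ξ t] B →
      (∀ ω ∈ B, randomNetwork G0 ξ t ω = G) → ∫ ω in B, F ω ∂μ ≤ ∫ ω in B, H ω ∂μ) :
    ∫ ω in A, F ω ∂μ ≤ ∫ ω in A, H ω ∂μ := by
  rw [hξ.setIntegral_eq_sum_randomNetwork G0 t hF (hξ.past_le t _ hA),
    hξ.setIntegral_eq_sum_randomNetwork G0 t hH (hξ.past_le t _ hA)]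
  exact Finset.sum_le_sum fun G _ => h G _
    (hA.inter (SubstitutionRules.measurableSet_randomNetwork_eq G0 t G)) fun ω hω => hω.2

end IsRandomChoice

omit mΩ in
theorem randomArcCount_succ_of_eq {t : ℕ} {ω : Ω} {G : ColoredNetwork L}
    (h : randomNetwork G0 ξ t ω = G) (j : Fin L) :
    S.randomArcCount G0 ξ (t + 1) ω j =
      ∑ e, ((S.R (G.color e) (ξ t (Fintype.equivFin G.E e) (G.color e) ω)).arcCount j : ℝ) := by
  change ((randomNetwork G0 ξ (t + 1) ω).arcCount j : ℝ) = _
  rw [randomNetwork_succ_of_eq G0 h, arcCount_substitute, Nat.cast_sum]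

omit mΩ in
theorem randomArcCount_of_eq {t : ℕ} {ω : Ω} {G : ColoredNetwork L}
    (h : randomNetwork G0 ξ t ω = G) : S.randomArcCount G0 ξ t ω = fun j => (G.arcCount j : ℝ) := by
  subst h
  rfl

namespace IsRandomChoice

theorem integrable_randomArcCount (hξ : S.IsRandomChoice μ ξ) (t : ℕ) (j : Fin L) :
    Integrable (fun ω => S.randomArcCount G0 ξ t ω j) μ :=
  hξ.integrable_comp_randomNetwork G0 t fun G => (G.arcCount j : ℝ)

open Matrix in
-- The conditional mean identity in integrated form: once the network is fixed, each arc contributes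
-- the row of M for its color, since its choice is independent of the past.
theorem setIntegral_randomArcCount_succ (hξ : S.IsRandomChoice μ ξ) {t : ℕ} {A : Set Ω}
    (hA : MeasurableSet[past ξ t] A) (j : Fin L) :
    ∫ ω in A, S.randomArcCount G0 ξ (t + 1) ω j ∂μ =
      ∑ i, (∫ ω in A, S.randomArcCount G0 ξ t ω i ∂μ) * S.arcMatrix i j := by
  have hmul : ∀ i, Integrable (fun ω => S.randomArcCount G0 ξ t ω i * S.arcMatrix i j) μ :=
    fun i => (hξ.integrable_randomArcCount G0 t i).mul_const _
  have key : ∀ (G : ColoredNetwork L) (B : Set Ω), MeasurableSet[past ξ t] B →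
      (∀ ω ∈ B, randomNetwork G0 ξ t ω = G) →
      ∫ ω in B, S.randomArcCount G0 ξ (t + 1) ω j ∂μ =
        ∫ ω in B, ∑ i, S.randomArcCount G0 ξ t ω i * S.arcMatrix i j ∂μ := by
    intro G B hB hBG
    have hB' := hξ.past_le t _ hB
    have hG : ∫ ω in B, ∑ i, S.randomArcCount G0 ξ t ω i * S.arcMatrix i j ∂μ =
        ∫ _ in B, ∑ i, (G.arcCount i : ℝ) * S.arcMatrix i j ∂μ :=
      setIntegral_congr_fun hB' fun ω hω => by simp only [randomArcCount_of_eq G0 (hBG ω hω)]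
    rw [hG,
      setIntegral_congr_fun hB' fun ω hω => randomArcCount_succ_of_eq G0 (hBG ω hω) j,
      integral_finsetSum _ fun e _ => (hξ.integrable_comp_choice t _ (G.color e)
        fun k => ((S.R (G.color e) k).arcCount j : ℝ)).integrableOn,
      setIntegral_const, G.sum_arcCount_mul fun i => S.arcMatrix i j, smul_eq_mul, Finset.mul_sum]
    exact Finset.sum_congr rfl fun e _ => hξ.setIntegral_choice hB _ (G.color e)
        fun k => ((S.R (G.color e) k).arcCount j : ℝ)
  have hint := integrable_finsetSum Finset.univ fun i _ => hmul i
  simp only [← integral_mul_const]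
  rw [← integral_finsetSum _ fun i _ => (hmul i).integrableOn]
  have hX := hξ.integrable_randomArcCount G0 (t + 1) j
  exact le_antisymm
    (hξ.setIntegral_mono_of_randomNetwork G0 t hX hint hA fun G B hB hBG => (key G B hB hBG).le)
    (hξ.setIntegral_mono_of_randomNetwork G0 t hint hX hA fun G B hB hBG => (key G B hB hBG).ge)

open Matrix in
theorem integral_randomArcCount (hξ : S.IsRandomChoice μ ξ) (t : ℕ) (j : Fin L) :
    ∫ ω, S.randomArcCount G0 ξ t ω j ∂μ =
      ((fun i => (G0.arcCount i : ℝ)) ᵥ* (S.arcMatrix ^ t)) j := by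
  induction t generalizing j with
  | zero =>
    rw [pow_zero, Matrix.vecMul_one]
    change ∫ _, (G0.arcCount j : ℝ) ∂μ = _
    simp
  | succ t ih =>
    have := hξ.setIntegral_randomArcCount_succ G0 (t := t) (MeasurableSet.univ) j
    simp only [Measure.restrict_univ, ih] at this
    rw [this, pow_succ, ← Matrix.vecMul_vecMul]
    rfl

open Matrix in
-- The martingale property of χ(Gᵗ)·v/rᵗ, integrated over past events.
theorem setIntegral_dotProduct (hξ : S.IsRandomChoice μ ξ) {v : Fin L → ℝ} {r : ℝ}
    (hv : S.arcMatrix *ᵥ v = r • v) {t : ℕ} {A : Set Ω}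
    (hA : MeasurableSet[past ξ t] A) (h : ℕ) :
    ∫ ω in A, S.randomArcCount G0 ξ (t + h) ω ⬝ᵥ v ∂μ =
      r ^ h * ∫ ω in A, S.randomArcCount G0 ξ t ω ⬝ᵥ v ∂μ := by
  have hsum : ∀ s, ∫ ω in A, S.randomArcCount G0 ξ s ω ⬝ᵥ v ∂μ =
      ∑ j, (∫ ω in A, S.randomArcCount G0 ξ s ω j ∂μ) * v j := fun s => by
    simp only [dotProduct]
    rw [integral_finsetSum _ fun j _ =>
      ((hξ.integrable_randomArcCount G0 s j).mul_const _).integrableOn]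
    simp only [integral_mul_const]
  induction h with
  | zero => simp
  | succ h ih =>
    rw [pow_succ', mul_assoc, ← ih, hsum, hsum, ← add_assoc, Finset.mul_sum]
    simp only [hξ.setIntegral_randomArcCount_succ G0 (past_mono (Nat.le_add_right t h) _ hA),
      Finset.sum_mul]
    rw [Finset.sum_comm]
    refine Finset.sum_congr rfl fun i _ => ?_
    have := congrFun hv i
    simp only [Matrix.mulVec, dotProduct, Pi.smul_apply, smul_eq_mul] at this
    simp only [mul_assoc, ← Finset.mul_sum, this]
    ring

end IsRandomChoice

end SubstitutionRules

/-! ### Second moments and growth of the number of arcs -/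

namespace SubstitutionRules

variable {L : ℕ} {S : SubstitutionRules L}

theorem arcMatrix_nonneg (i j : Fin L) : 0 ≤ S.arcMatrix i j := by
  rw [arcMatrix, Matrix.of_apply]
  exact Finset.sum_nonneg fun k _ => mul_nonneg (S.p_nonneg i k) (Nat.cast_nonneg _)

theorem arcCount_le_maxArcs (i j : Fin L) (k : Fin (S.q i)) :
    ((S.R i k).arcCount j : ℝ) ≤ S.maxArcs := by
  exact_mod_cast ((S.R i k).arcCount_le_card j).trans (S.card_le_maxArcs i k)

theorem arcMatrix_le_maxArcs (i j : Fin L) : S.arcMatrix i j ≤ S.maxArcs := by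
  rw [← one_mul (S.maxArcs : ℝ), ← S.p_sum i, Finset.sum_mul, arcMatrix, Matrix.of_apply]
  exact Finset.sum_le_sum fun k _ =>
    mul_le_mul_of_nonneg_left (arcCount_le_maxArcs i j k) (S.p_nonneg i k)

theorem card_le_card_substitute {G : ColoredNetwork L} {κ : (e : G.E) → Fin (S.q (G.color e))}
    (h : ∀ e, 1 ≤ Fintype.card (S.R (G.color e) (κ e)).E) :
    Fintype.card G.E ≤ Fintype.card (S.substitute G κ).E := by
  rw [card_substitute, Fintype.card_eq_sum_ones]
  exact Finset.sum_le_sum fun e _ => h e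

theorem card_lt_card_substitute {G : ColoredNetwork L} {κ : (e : G.E) → Fin (S.q (G.color e))}
    (h : ∀ e, 1 ≤ Fintype.card (S.R (G.color e) (κ e)).E) {e : G.E}
    (he : 2 ≤ Fintype.card (S.R (G.color e) (κ e)).E) :
    Fintype.card G.E < Fintype.card (S.substitute G κ).E := by
  rw [card_substitute, Fintype.card_eq_sum_ones]
  exact Finset.sum_lt_sum (fun e _ => h e) ⟨e, Finset.mem_univ e, he⟩

theorem sum_mul_arcCount_sub_arcMatrix (i j : Fin L) :
    ∑ k, S.p i k * (((S.R i k).arcCount j : ℝ) - S.arcMatrix i j) = 0 := by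
  simp only [mul_sub, Finset.sum_sub_distrib, ← Finset.sum_mul, S.p_sum, one_mul]
  exact sub_self _

theorem sum_mul_arcCount_sub_arcMatrix_sq_le (i j : Fin L) :
    ∑ k, S.p i k * ((((S.R i k).arcCount j : ℝ) - S.arcMatrix i j) *
      (((S.R i k).arcCount j : ℝ) - S.arcMatrix i j)) ≤ (S.maxArcs : ℝ) ^ 2 := by
  rw [← one_mul ((S.maxArcs : ℝ) ^ 2), ← S.p_sum i, Finset.sum_mul]
  refine Finset.sum_le_sum fun k _ => mul_le_mul_of_nonneg_left ?_ (S.p_nonneg i k)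
  rw [← sq]
  refine sq_le_sq' ?_ ?_
  · linarith [arcMatrix_le_maxArcs (S := S) i j, Nat.cast_nonneg (α := ℝ) ((S.R i k).arcCount j)]
  · linarith [arcCount_le_maxArcs i j k, arcMatrix_nonneg (S := S) i j]

variable {Ω : Type*} [mΩ : MeasurableSpace Ω] {μ : Measure Ω}
  [IsProbabilityMeasure μ] {ξ : ℕ → ℕ → (i : Fin L) → Ω → Fin (S.q i)} (G0 : ColoredNetwork L)

open Matrix in
/-- The deviation of the arc counts after `t + 1` steps from their expectation given the first
`t` steps. -/
noncomputable def increment (ξ : ℕ → ℕ → (i : Fin L) → Ω → Fin (S.q i)) (t : ℕ) (ω : Ω) :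
    Fin L → ℝ :=
  S.randomArcCount G0 ξ (t + 1) ω - S.randomArcCount G0 ξ t ω ᵥ* S.arcMatrix

omit mΩ in
open Matrix in
theorem increment_of_eq {t : ℕ} {ω : Ω} {G : ColoredNetwork L}
    (h : randomNetwork G0 ξ t ω = G) (j : Fin L) :
    increment G0 ξ t ω j =
      ∑ e, (((S.R (G.color e) (ξ t (Fintype.equivFin G.E e) (G.color e) ω)).arcCount j : ℝ) -
        S.arcMatrix (G.color e) j) := by
  rw [Finset.sum_sub_distrib, ← G.sum_arcCount_mul fun i => S.arcMatrix i j,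
    ← randomArcCount_succ_of_eq G0 h j, increment, randomArcCount_of_eq G0 h]
  rfl

namespace IsRandomChoice

theorem memLp_comp_randomNetwork (hξ : S.IsRandomChoice μ ξ) (t : ℕ)
    (f : ColoredNetwork L → ℝ) : MemLp (fun ω => f (randomNetwork G0 ξ t ω)) 2 μ := by
  obtain ⟨C, hC⟩ := ((finite_range_randomNetwork (ξ := ξ) G0 t).image fun G => ‖f G‖).bddAbove
  exact .of_bound (hξ.measurable_comp_randomNetwork G0 t f).aestronglyMeasurable C
    (ae_of_all _ fun ω => hC ⟨_, ⟨ω, rfl⟩, rfl⟩)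

open Matrix in
theorem memLp_increment (hξ : S.IsRandomChoice μ ξ) (t : ℕ) (j : Fin L) :
    MemLp (fun ω => increment G0 ξ t ω j) 2 μ :=
  (hξ.memLp_comp_randomNetwork G0 (t + 1) fun G => (G.arcCount j : ℝ)).sub
    (hξ.memLp_comp_randomNetwork G0 t fun G => ((fun i => (G.arcCount i : ℝ)) ᵥ* S.arcMatrix) j)

/-- Given the network, the increment is a sum over arcs of centred variables of size at most
`S.maxArcs`. Distinct arcs use independent choices, so the cross terms vanish and only one square
per arc remains. -/
theorem setIntegral_increment_sq_le (hξ : S.IsRandomChoice μ ξ) {t : ℕ} {A : Set Ω}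
    (hA : MeasurableSet[past ξ t] A) (j : Fin L) :
    ∫ ω in A, increment G0 ξ t ω j ^ 2 ∂μ ≤
      ∫ ω in A, (S.maxArcs : ℝ) ^ 2 * Fintype.card (randomNetwork G0 ξ t ω).E ∂μ := by
  refine hξ.setIntegral_mono_of_randomNetwork G0 t (hξ.memLp_increment G0 t j).integrable_sq
    ((hξ.integrable_comp_randomNetwork G0 t fun G => (Fintype.card G.E : ℝ)).const_mul _) hA
    fun G B hB hBG => ?_
  have hB' := hξ.past_le t _ hB
  set f : (e : G.E) → Fin (S.q (G.color e)) → ℝ := fun e k =>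
    ((S.R (G.color e) k).arcCount j : ℝ) - S.arcMatrix (G.color e) j with hf
  set x : (e : G.E) → Ω → Fin (S.q (G.color e)) := fun e =>
    ξ t (Fintype.equivFin G.E e) (G.color e)
  have hL : ∫ ω in B, increment G0 ξ t ω j ^ 2 ∂μ =
      ∫ ω in B, ∑ e, ∑ e', f e (x e ω) * f e' (x e' ω) ∂μ :=
    setIntegral_congr_fun hB' fun ω hω => by
      simp only [increment_of_eq G0 (hBG ω hω), sq, Finset.sum_mul_sum, f, x]
  have hR : ∫ ω in B, (S.maxArcs : ℝ) ^ 2 * Fintype.card (randomNetwork G0 ξ t ω).E ∂μ =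
      ∫ _ in B, (S.maxArcs : ℝ) ^ 2 * Fintype.card G.E ∂μ :=
    setIntegral_congr_fun hB' fun ω hω => by
      rw [hBG ω hω]
  have hLp : ∀ e, MemLp (fun ω => f e (x e ω)) 2 μ := fun e => by
    obtain ⟨C, hC⟩ := (Set.finite_range fun k => ‖f e k‖).bddAbove
    exact .of_bound (hξ.integrable_comp_choice t _ (G.color e) (f e)).aestronglyMeasurable C
      (ae_of_all _ fun ω => hC ⟨_, rfl⟩)
  have hint : ∀ e e', Integrable (fun ω => f e (x e ω) * f e' (x e' ω)) μ := fun e e' =>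
    (hLp e).integrable_mul (hLp e')
  have hdiag : ∀ e, ∑ e', ∫ ω in B, f e (x e ω) * f e' (x e' ω) ∂μ ≤
      μ.real B * (S.maxArcs : ℝ) ^ 2 := by
    intro e
    rw [Finset.sum_eq_single e]
    · rw [hξ.setIntegral_choice hB _ (G.color e) fun k => f e k * f e k]
      exact mul_le_mul_of_nonneg_left (sum_mul_arcCount_sub_arcMatrix_sq_le _ _) measureReal_nonneg
    · intro e' _ hne
      rw [hξ.setIntegral_choice_mul_choice hB (fun h => hne
        ((Fintype.equivFin G.E).injective (Fin.ext h)).symm) _ _ (f e) (f e')]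
      simp [hf, sum_mul_arcCount_sub_arcMatrix]
    · simp
  rw [hL, hR, integral_finsetSum _ fun e _ =>
    (integrable_finsetSum _ fun e' _ => hint e e').integrableOn, setIntegral_const, smul_eq_mul]
  calc ∑ e, ∫ ω in B, ∑ e', f e (x e ω) * f e' (x e' ω) ∂μ
      = ∑ e, ∑ e', ∫ ω in B, f e (x e ω) * f e' (x e' ω) ∂μ :=
        Finset.sum_congr rfl fun e _ => integral_finsetSum _ fun e' _ => (hint e e').integrableOn
    _ ≤ ∑ _e : G.E, μ.real B * (S.maxArcs : ℝ) ^ 2 := Finset.sum_le_sum fun e _ => hdiag e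
    _ = μ.real B * ((S.maxArcs : ℝ) ^ 2 * Fintype.card G.E) := by
        rw [Finset.sum_const, Finset.card_univ, nsmul_eq_mul]
        ring

omit [IsProbabilityMeasure μ] in
theorem ae_one_le_card (hξ : S.IsRandomChoice μ ξ) (hS : S.Admissible) (hG0 : Nonempty G0.E) :
    ∀ᵐ ω ∂μ, ∀ t, 1 ≤ Fintype.card (randomNetwork G0 ξ t ω).E := by
  filter_upwards [hξ.ae_choice_pos] with ω hω t
  induction t with
  | zero => exact Fintype.card_pos_iff.2 hG0
  | succ t ih =>
    rw [randomNetwork_succ_of_eq G0 rfl]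
    exact ih.trans (card_le_card_substitute fun e => hS.one_le_card (hω _ _ _))

/-- The number of arcs grows, in the sense that `𝔼 2⁻ᴺ` decays geometrically. -/
theorem exists_integral_half_pow_card_le (hξ : S.IsRandomChoice μ ξ) (hS : S.Admissible)
    [Nonempty (Fin L)] (hG0 : Nonempty G0.E) :
    ∃ q : ℝ, 0 ≤ q ∧ q < 1 ∧ ∀ t,
      ∫ ω, (1 / 2 : ℝ) ^ Fintype.card (randomNetwork G0 ξ t ω).E ∂μ ≤ q ^ t := by
  choose k hk hk2 using hS.exists_two_le_card
  obtain ⟨a, -, ha⟩ := Finset.exists_min_image Finset.univ (fun i => S.p i (k i))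
    Finset.univ_nonempty
  have hle1 : S.p a (k a) ≤ 1 :=
    (Finset.single_le_sum (fun l _ => S.p_nonneg a l) (Finset.mem_univ _)).trans (S.p_sum a).le
  -- It suffices to follow one arc: with probability at least `S.p a (k a)` it yields two or more
  -- arcs, which at least halves 2⁻ᴺ; otherwise 2⁻ᴺ does not increase.
  set q : ℝ := 1 - S.p a (k a) / 2 with hq
  refine ⟨q, by linarith, by linarith [hk a], fun t => ?_⟩
  have hint : ∀ t, Integrable (fun ω =>
      (1 / 2 : ℝ) ^ Fintype.card (randomNetwork G0 ξ t ω).E) μ := fun t =>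
    hξ.integrable_comp_randomNetwork G0 t fun G => (1 / 2 : ℝ) ^ Fintype.card G.E
  induction t with
  | zero =>
    rw [pow_zero]
    refine (integral_mono (hint 0) (integrable_const 1) fun ω => ?_).trans (by simp)
    exact pow_le_one₀ (by norm_num) (by norm_num)
  | succ t ih =>
    have step : ∫ ω in Set.univ, (1 / 2 : ℝ) ^ Fintype.card (randomNetwork G0 ξ (t + 1) ω).E ∂μ ≤
        ∫ ω in Set.univ, q * (1 / 2 : ℝ) ^ Fintype.card (randomNetwork G0 ξ t ω).E ∂μ := by
      refine hξ.setIntegral_mono_of_randomNetwork G0 t (hint _) ((hint _).const_mul _)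
        MeasurableSet.univ fun G B hB hBG => ?_
      have hB' := hξ.past_le t _ hB
      rcases isEmpty_or_nonempty G.E with hG | ⟨⟨e⟩⟩
      · have h0 : μ B = 0 := by
          refine measure_eq_zero_iff_ae_notMem.2 ?_
          filter_upwards [hξ.ae_one_le_card G0 hS hG0] with ω hω hωB
          have := hω t
          rw [hBG ω hωB, Fintype.card_eq_zero] at this
          omega
        rw [setIntegral_measure_zero _ h0, setIntegral_measure_zero _ h0]
      set f : Fin (S.q (G.color e)) → ℝ := fun l =>
        1 - (1 / 2) * if l = k (G.color e) then 1 else 0 with hf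
      have hpt : ∀ᵐ ω ∂μ, ω ∈ B →
          (1 / 2 : ℝ) ^ Fintype.card (randomNetwork G0 ξ (t + 1) ω).E ≤
          (1 / 2) ^ Fintype.card G.E * f (ξ t (Fintype.equivFin G.E e) (G.color e) ω) := by
        filter_upwards [hξ.ae_choice_pos] with ω hω hωB
        rw [randomNetwork_succ_of_eq G0 (hBG ω hωB)]
        have h1 : ∀ e' : G.E, 1 ≤ Fintype.card
            (S.R (G.color e') (ξ t (Fintype.equivFin G.E e') (G.color e') ω)).E :=
          fun e' => hS.one_le_card (hω _ _ _)
        by_cases hl : ξ t (Fintype.equivFin G.E e) (G.color e) ω = k (G.color e)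
        · simp only [hf, hl, if_true]
          refine (pow_le_pow_of_le_one (by norm_num) (by norm_num)
            (card_lt_card_substitute h1 (e := e) (hl ▸ hk2 _))).trans (le_of_eq ?_)
          rw [Nat.succ_eq_add_one, pow_succ]
          norm_num
        · simp only [hf, hl, if_false, mul_zero, sub_zero, mul_one]
          exact pow_le_pow_of_le_one (by norm_num) (by norm_num) (card_le_card_substitute h1)
      have hsum : ∑ l, S.p (G.color e) l * f l ≤ q := by
        simp only [hf, mul_sub, mul_one, Finset.sum_sub_distrib, S.p_sum]
        have : ∑ l, S.p (G.color e) l * (1 / 2 * if l = k (G.color e) then (1 : ℝ) else 0) =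
            S.p (G.color e) (k (G.color e)) * (1 / 2) := by
          simp
        rw [this]
        linarith [ha (G.color e) (Finset.mem_univ _)]
      have hR : ∫ ω in B, q * (1 / 2 : ℝ) ^ Fintype.card (randomNetwork G0 ξ t ω).E ∂μ =
          ∫ _ in B, q * (1 / 2 : ℝ) ^ Fintype.card G.E ∂μ :=
        setIntegral_congr_fun hB' fun ω hω => by
          rw [hBG ω hω]
      rw [hR, setIntegral_const, smul_eq_mul]
      refine (setIntegral_mono_on_ae (hint _).integrableOn
        ((hξ.integrable_comp_choice t _ (G.color e) f).const_mul _).integrableOn hB' hpt).trans ?_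
      rw [integral_const_mul, hξ.setIntegral_choice hB]
      have hp : (0 : ℝ) ≤ (1 / 2) ^ Fintype.card G.E := by positivity
      have hm : 0 ≤ μ.real B := measureReal_nonneg
      calc (1 / 2 : ℝ) ^ Fintype.card G.E * (μ.real B * ∑ l, S.p (G.color e) l * f l)
          ≤ (1 / 2 : ℝ) ^ Fintype.card G.E * (μ.real B * q) := by gcongr
        _ = μ.real B * (q * (1 / 2) ^ Fintype.card G.E) := by ring
    rw [setIntegral_univ, setIntegral_univ, integral_const_mul] at step
    refine step.trans ?_
    rw [pow_succ']
    exact mul_le_mul_of_nonneg_left ih (by linarith)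

end IsRandomChoice

end SubstitutionRules

/-! ### Summable deviations and survival -/

namespace SubstitutionRules

open Matrix

variable {L : ℕ} {S : SubstitutionRules L} {Ω : Type*} [mΩ : MeasurableSpace Ω] {μ : Measure Ω}
  [IsProbabilityMeasure μ] {ξ : ℕ → ℕ → (i : Fin L) → Ω → Fin (S.q i)} (G0 : ColoredNetwork L)

omit mΩ in
theorem randomArcCount_dotProduct (t : ℕ) (ω : Ω) (v : Fin L → ℝ) :
    S.randomArcCount G0 ξ t ω ⬝ᵥ v =
      ∑ e, v ((randomNetwork G0 ξ t ω).color e) :=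
  (randomNetwork G0 ξ t ω).sum_arcCount_mul v

omit mΩ in
theorem mul_card_le_dotProduct {v : Fin L → ℝ} {c : ℝ} (hc : ∀ i, c ≤ v i) (t : ℕ) (ω : Ω) :
    c * Fintype.card (randomNetwork G0 ξ t ω).E ≤ S.randomArcCount G0 ξ t ω ⬝ᵥ v := by
  rw [randomArcCount_dotProduct, mul_comm, ← nsmul_eq_mul, ← Finset.card_univ]
  exact Finset.card_nsmul_le_sum _ _ _ fun e _ => hc _

omit mΩ in
theorem dotProduct_le_mul_card {v : Fin L → ℝ} {c : ℝ} (hc : ∀ i, v i ≤ c) (t : ℕ) (ω : Ω) :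
    S.randomArcCount G0 ξ t ω ⬝ᵥ v ≤ c * Fintype.card (randomNetwork G0 ξ t ω).E := by
  rw [randomArcCount_dotProduct, mul_comm, ← nsmul_eq_mul, ← Finset.card_univ]
  exact Finset.sum_le_card_nsmul _ _ _ fun e _ => hc _

/-- The normalized deviation at step `t`. -/
noncomputable def scaledDeviation (ξ : ℕ → ℕ → (i : Fin L) → Ω → Fin (S.q i)) (v : Fin L → ℝ)
    (r : ℝ) (t : ℕ) (ω : Ω) : ℝ :=
  (r ^ (t + 1))⁻¹ * weightedNorm v (increment G0 ξ t ω)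

omit mΩ in
theorem scaledDeviation_nonneg {v : Fin L → ℝ} (hv0 : ∀ i, 0 < v i) {r : ℝ} (hr : 1 < r) (t : ℕ)
    (ω : Ω) : 0 ≤ scaledDeviation G0 ξ v r t ω :=
  mul_nonneg (by positivity) (weightedNorm_nonneg hv0 _)

omit mΩ in
theorem scaledDeviation_eq {v : Fin L → ℝ} {r : ℝ} (hr : 1 < r) (t : ℕ) (ω : Ω) :
    scaledDeviation G0 ξ v r t ω =
      weightedNorm v ((r ^ (t + 1))⁻¹ • S.randomArcCount G0 ξ (t + 1) ω -
        ((r ^ t)⁻¹ • S.randomArcCount G0 ξ t ω) ᵥ* (r⁻¹ • S.arcMatrix)) := by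
  have h : (r ^ (t + 1))⁻¹ • S.randomArcCount G0 ξ (t + 1) ω -
      ((r ^ t)⁻¹ • S.randomArcCount G0 ξ t ω) ᵥ* (r⁻¹ • S.arcMatrix) =
      (r ^ (t + 1))⁻¹ • increment G0 ξ t ω := by
    rw [increment, Matrix.smul_vecMul, Matrix.vecMul_smul, smul_smul, ← mul_inv, ← pow_succ,
      smul_sub]
  have hr0 : 0 ≤ (r ^ (t + 1))⁻¹ := by positivity
  rw [h, scaledDeviation, weightedNorm, weightedNorm, Finset.mul_sum]
  simp only [Pi.smul_apply, smul_eq_mul, abs_mul, abs_of_nonneg hr0, mul_assoc]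

omit mΩ in
-- A pathwise bound: the normalized process cannot fall by more than the sum of the deviations, so
-- tending to zero forces that sum to be large.
theorem dotProduct_le_add_scaledDeviation {v : Fin L → ℝ} (hv0 : ∀ i, 0 < v i) {r : ℝ}
    (hr : 1 < r) (hv : S.arcMatrix *ᵥ v = r • v) (t h : ℕ) (ω : Ω) :
    (r ^ t)⁻¹ * (S.randomArcCount G0 ξ t ω ⬝ᵥ v) ≤
      (r ^ (t + h))⁻¹ * (S.randomArcCount G0 ξ (t + h) ω ⬝ᵥ v) +
        ∑ s ∈ Finset.range h, scaledDeviation G0 ξ v r (t + s) ω := by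
  induction h with
  | zero => simp
  | succ h ih =>
    refine ih.trans ?_
    rw [Finset.sum_range_succ, ← add_assoc t h 1]
    have h1 : S.randomArcCount G0 ξ (t + h + 1) ω ⬝ᵥ v =
        r * (S.randomArcCount G0 ξ (t + h) ω ⬝ᵥ v) + increment G0 ξ (t + h) ω ⬝ᵥ v := by
      rw [increment, sub_dotProduct, ← Matrix.dotProduct_mulVec, hv, dotProduct_smul, smul_eq_mul]
      ring
    have h2 := neg_le_of_abs_le (abs_dotProduct_le_weightedNorm hv0 (increment G0 ξ (t + h) ω))
    have h3 : (r ^ (t + h))⁻¹ = (r ^ (t + h + 1))⁻¹ * r := by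
      rw [pow_succ, mul_inv, mul_assoc, inv_mul_cancel₀ (by positivity), mul_one]
    have h4 : 0 ≤ (r ^ (t + h + 1))⁻¹ := by positivity
    rw [scaledDeviation, h1, h3]
    nlinarith [mul_le_mul_of_nonneg_left h2 h4]

namespace IsRandomChoice

theorem integrable_weightedNorm_increment (hξ : S.IsRandomChoice μ ξ) (v : Fin L → ℝ) (t : ℕ) :
    Integrable (fun ω => weightedNorm v (increment G0 ξ t ω)) μ :=
  integrable_finsetSum _ fun j _ =>
    ((hξ.memLp_increment G0 t j).integrable one_le_two).abs.mul_const _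

/-- From N arcs, the mean number of arcs after `h` further steps is O(rʰN), so the second moment
bound makes the increment of order √(rʰN) in L¹. The constant does not depend on `t`, `h` or `G`. -/
theorem exists_setIntegral_weightedNorm_le (hξ : S.IsRandomChoice μ ξ) [Nonempty (Fin L)]
    {v : Fin L → ℝ} (hv0 : ∀ i, 0 < v i) {r : ℝ} (hr : 1 < r)
    (hv : S.arcMatrix *ᵥ v = r • v) :
    ∃ C : ℝ, 0 ≤ C ∧ ∀ (t h : ℕ) (G : ColoredNetwork L) (B : Set Ω), MeasurableSet[past ξ t] B →
      (∀ ω ∈ B, randomNetwork G0 ξ t ω = G) → 1 ≤ Fintype.card G.E →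
      ∫ ω in B, weightedNorm v (increment G0 ξ (t + h) ω) ∂μ ≤
        C * (μ.real B * (√r ^ h * √(Fintype.card G.E))) := by
  obtain ⟨a, -, ha⟩ := Finset.exists_min_image Finset.univ v Finset.univ_nonempty
  set V : ℝ := ∑ i, v i
  have hV : ∀ i, v i ≤ V := fun i =>
    Finset.single_le_sum (fun j _ => (hv0 j).le) (Finset.mem_univ i)
  have hV0 : 0 ≤ V := Finset.sum_nonneg fun i _ => (hv0 i).le
  have hva := hv0 a
  set b : ℝ := (S.maxArcs : ℝ) ^ 2
  have hb : 0 ≤ b := by positivity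
  refine ⟨V * ((1 + b * (V / v a)) / 2), by positivity, fun t h G B hB hBG hG => ?_⟩
  have hN : (0 : ℝ) < Fintype.card G.E := by exact_mod_cast hG
  set N : ℝ := (Fintype.card G.E : ℝ)
  set x : ℝ := √r ^ h * √N
  have hx : 0 < x := by positivity
  have hxx : x * x = r ^ h * N := by
    rw [mul_mul_mul_comm, ← mul_pow, Real.mul_self_sqrt (by linarith), Real.mul_self_sqrt hN.le]
  have hP : 0 ≤ μ.real B := measureReal_nonneg
  have hB' := hξ.past_le t _ hB
  have hcard : ∀ s, Integrable
      (fun ω => (Fintype.card (randomNetwork G0 ξ s ω).E : ℝ)) μ := fun s =>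
    hξ.integrable_comp_randomNetwork G0 s fun G => (Fintype.card G.E : ℝ)
  have hdot : ∀ s, Integrable (fun ω => S.randomArcCount G0 ξ s ω ⬝ᵥ v) μ := fun s =>
    hξ.integrable_comp_randomNetwork G0 s fun G => (fun j => (G.arcCount j : ℝ)) ⬝ᵥ v
  have hmean : ∫ ω in B, (Fintype.card (randomNetwork G0 ξ (t + h) ω).E : ℝ) ∂μ ≤
      V / v a * (μ.real B * (x * x)) := by
    have h1 : ∫ ω in B, v a * (Fintype.card (randomNetwork G0 ξ (t + h) ω).E : ℝ) ∂μ ≤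
        ∫ ω in B, S.randomArcCount G0 ξ (t + h) ω ⬝ᵥ v ∂μ :=
      integral_mono ((hcard _).const_mul _).integrableOn (hdot _).integrableOn fun ω =>
        mul_card_le_dotProduct G0 (fun i => ha i (Finset.mem_univ i)) _ ω
    have h2 : ∫ ω in B, S.randomArcCount G0 ξ t ω ⬝ᵥ v ∂μ ≤ ∫ _ in B, V * N ∂μ :=
      setIntegral_mono_on (hdot _).integrableOn (integrable_const _).integrableOn hB' fun ω hω => by
        have := dotProduct_le_mul_card (ξ := ξ) G0 hV t ω
        rwa [hBG ω hω] at this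
    rw [integral_const_mul, hξ.setIntegral_dotProduct G0 hv hB] at h1
    rw [setIntegral_const, smul_eq_mul] at h2
    rw [div_mul_eq_mul_div, le_div_iff₀ hva, mul_comm, hxx]
    refine h1.trans ((mul_le_mul_of_nonneg_left h2 (by positivity)).trans (le_of_eq ?_))
    ring
  have hj : ∀ j, ∫ ω in B, |increment G0 ξ (t + h) ω j| ∂μ ≤
      (1 + b * (V / v a)) / 2 * (μ.real B * x) := by
    intro j
    have hsq := (hξ.memLp_increment G0 (t + h) j).integrable_sq
    calc ∫ ω in B, |increment G0 ξ (t + h) ω j| ∂μ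
        ≤ ∫ ω in B, (x / 2 + (2 * x)⁻¹ * increment G0 ξ (t + h) ω j ^ 2) ∂μ := by
          refine integral_mono
            ((hξ.memLp_increment G0 (t + h) j).integrable one_le_two).abs.integrableOn
            ((integrable_const _).add (hsq.const_mul _)).integrableOn fun ω => ?_
          -- The inequality |d| ≤ x/2 + d²/(2x), with `x` the expected order of magnitude, replaces
          -- Cauchy–Schwarz.
          have : 0 ≤ (2 * x)⁻¹ * (|increment G0 ξ (t + h) ω j| - x) ^ 2 := by positivity
          have e : (2 * x)⁻¹ * (|increment G0 ξ (t + h) ω j| - x) ^ 2 =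
              x / 2 + (2 * x)⁻¹ * increment G0 ξ (t + h) ω j ^ 2 -
                |increment G0 ξ (t + h) ω j| := by
            rw [sub_sq, sq_abs]
            field_simp
            ring
          simp only
          linarith
      _ = μ.real B * (x / 2) +
          (2 * x)⁻¹ * ∫ ω in B, increment G0 ξ (t + h) ω j ^ 2 ∂μ := by
          rw [integral_add (integrable_const _).integrableOn (hsq.const_mul _).integrableOn,
            setIntegral_const, smul_eq_mul, integral_const_mul]
      _ ≤ μ.real B * (x / 2) + (2 * x)⁻¹ * (b * (V / v a * (μ.real B * (x * x)))) := by
          gcongr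
          refine (hξ.setIntegral_increment_sq_le G0 (past_mono (Nat.le_add_right t h) _ hB) j).trans
            ?_
          rw [integral_const_mul]
          exact mul_le_mul_of_nonneg_left hmean hb
      _ = _ := by
          field_simp
  simp only [weightedNorm]
  rw [integral_finsetSum _ fun j _ =>
    (((hξ.memLp_increment G0 (t + h) j).integrable one_le_two).abs.mul_const _).integrableOn]
  simp only [integral_mul_const]
  calc ∑ j, (∫ ω in B, |increment G0 ξ (t + h) ω j| ∂μ) * v j
      ≤ ∑ j, (1 + b * (V / v a)) / 2 * (μ.real B * x) * v j :=
        Finset.sum_le_sum fun j _ => mul_le_mul_of_nonneg_right (hj j) (hv0 j).le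
    _ = _ := by
        rw [← Finset.mul_sum]
        ring

/-- After normalization, the bounds form a geometric series with ratio 1/√r. The case `t = 0` yields
almost sure summability; general `t` yields the extinction estimate. -/
theorem exists_lintegral_tsum_scaledDeviation_le (hξ : S.IsRandomChoice μ ξ) [Nonempty (Fin L)]
    {v : Fin L → ℝ} (hv0 : ∀ i, 0 < v i) {r : ℝ} (hr : 1 < r)
    (hv : S.arcMatrix *ᵥ v = r • v) :
    ∃ C : ℝ, 0 ≤ C ∧ ∀ (t : ℕ) (G : ColoredNetwork L) (B : Set Ω), MeasurableSet[past ξ t] B →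
      (∀ ω ∈ B, randomNetwork G0 ξ t ω = G) → 1 ≤ Fintype.card G.E →
      ∫⁻ ω in B, ∑' h, ENNReal.ofReal (scaledDeviation G0 ξ v r (t + h) ω) ∂μ ≤
        ENNReal.ofReal (C * ((r ^ t)⁻¹ * (μ.real B * √(Fintype.card G.E)))) := by
  obtain ⟨C, hC, hle⟩ := hξ.exists_setIntegral_weightedNorm_le G0 hv0 hr hv
  have hs1 : 1 < √r := Real.lt_sqrt_of_sq_lt (by linarith)
  have hs : (√r)⁻¹ < 1 := inv_lt_one_of_one_lt₀ hs1
  have hs0 : 0 ≤ (√r)⁻¹ := by positivity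
  have hgeo := (hasSum_geometric_of_lt_one hs0 hs)
  refine ⟨C * r⁻¹ * (1 - (√r)⁻¹)⁻¹, mul_nonneg (by positivity) (inv_nonneg.2 (by linarith)),
    fun t G B hB hBG hG => ?_⟩
  have hint : ∀ s, Integrable (scaledDeviation G0 ξ v r s) μ := fun s =>
    (hξ.integrable_weightedNorm_increment G0 v s).const_mul _
  rw [lintegral_tsum fun h => (hint _).aestronglyMeasurable.aemeasurable.ennreal_ofReal.restrict]
  have hP : 0 ≤ μ.real B := measureReal_nonneg
  set D : ℝ := C * r⁻¹ * ((r ^ t)⁻¹ * (μ.real B * √(Fintype.card G.E))) with hD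
  have hterm : ∀ h, ∫⁻ ω in B, ENNReal.ofReal (scaledDeviation G0 ξ v r (t + h) ω) ∂μ ≤
      ENNReal.ofReal (D * (√r)⁻¹ ^ h) := by
    intro h
    rw [← ofReal_integral_eq_lintegral_ofReal (hint _).integrableOn
      (ae_of_all _ fun ω => scaledDeviation_nonneg G0 hv0 hr _ ω)]
    refine ENNReal.ofReal_le_ofReal ?_
    simp only [scaledDeviation]
    rw [integral_const_mul]
    refine (mul_le_mul_of_nonneg_left (hle t h G B hB hBG hG) (by positivity)).trans (le_of_eq ?_)
    have hrr : r ^ h = √r ^ h * √r ^ h := by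
      rw [← mul_pow, Real.mul_self_sqrt (by linarith)]
    rw [hD, pow_succ, pow_add, hrr, inv_pow]
    have : √r ^ h ≠ 0 := by positivity
    field_simp
  refine (ENNReal.tsum_le_tsum hterm).trans (le_of_eq ?_)
  rw [← ENNReal.ofReal_tsum_of_nonneg (fun h => by positivity) (hgeo.summable.mul_left D),
    tsum_mul_left, hgeo.tsum_eq, hD]
  congr 1
  ring

theorem ae_summable_scaledDeviation (hξ : S.IsRandomChoice μ ξ) [Nonempty (Fin L)]
    (hG0 : Nonempty G0.E) {v : Fin L → ℝ} (hv0 : ∀ i, 0 < v i) {r : ℝ} (hr : 1 < r)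
    (hv : S.arcMatrix *ᵥ v = r • v) :
    ∀ᵐ ω ∂μ, Summable fun t => scaledDeviation G0 ξ v r t ω := by
  obtain ⟨C, -, hle⟩ := hξ.exists_lintegral_tsum_scaledDeviation_le G0 hv0 hr hv
  have h := hle 0 G0 Set.univ MeasurableSet.univ (fun ω _ => rfl) (Fintype.card_pos_iff.2 hG0)
  rw [setLIntegral_univ] at h
  have hint : ∀ s, Integrable (scaledDeviation G0 ξ v r s) μ := fun s =>
    (hξ.integrable_weightedNorm_increment G0 v s).const_mul _
  have hfin := ae_lt_top' (AEMeasurable.tsum fun h =>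
    (hint (0 + h)).aestronglyMeasurable.aemeasurable.ennreal_ofReal)
    (h.trans_lt ENNReal.ofReal_lt_top).ne
  filter_upwards [hfin] with ω hω
  have := ENNReal.summable_toReal hω.ne
  simpa only [zero_add, ENNReal.toReal_ofReal (scaledDeviation_nonneg G0 hv0 hr _ ω)] using this

/-- On extinction, the initial value, at least `v a * N / r ^ t`, must be used up by deviations
whose expected sum is O(√N/rᵗ) given `G`; Markov's inequality gives conditional probability O(1/√N).
The product form avoids dividing by the probability of the event. -/
theorem exists_measureReal_extinction_le (hξ : S.IsRandomChoice μ ξ) [Nonempty (Fin L)]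
    {v : Fin L → ℝ} (hv0 : ∀ i, 0 < v i) {r : ℝ} (hr : 1 < r)
    (hv : S.arcMatrix *ᵥ v = r • v) :
    ∃ C : ℝ, 0 ≤ C ∧ ∀ (t : ℕ) (G : ColoredNetwork L), 1 ≤ Fintype.card G.E →
      √(Fintype.card G.E) * μ.real ({ω | Tendsto
        (fun s => (r ^ s)⁻¹ * (S.randomArcCount G0 ξ s ω ⬝ᵥ v)) atTop (𝓝 0)} ∩
        {ω | randomNetwork G0 ξ t ω = G}) ≤ C * μ.real {ω | randomNetwork G0 ξ t ω = G} := by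
  obtain ⟨C, hC, hle⟩ := hξ.exists_lintegral_tsum_scaledDeviation_le G0 hv0 hr hv
  obtain ⟨a, -, ha⟩ := Finset.exists_min_image Finset.univ v Finset.univ_nonempty
  have hva := hv0 a
  refine ⟨C / v a, by positivity, fun t G hG => ?_⟩
  set B := {ω | randomNetwork G0 ξ t ω = G}
  set Z := {ω | Tendsto (fun s => (r ^ s)⁻¹ * (S.randomArcCount G0 ξ s ω ⬝ᵥ v)) atTop (𝓝 0)}
  have hB := hξ.measurableSet_randomNetwork_eq G0 t G
  have hN : (0 : ℝ) < Fintype.card G.E := by exact_mod_cast hG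
  set N : ℝ := (Fintype.card G.E : ℝ)
  set y : ℝ := (r ^ t)⁻¹ * (v a * N) with hy
  set F : Ω → ENNReal := fun ω => ∑' h, ENNReal.ofReal (scaledDeviation G0 ξ v r (t + h) ω)
  have hint : ∀ s, Integrable (scaledDeviation G0 ξ v r s) μ := fun s =>
    (hξ.integrable_weightedNorm_increment G0 v s).const_mul _
  have hF : AEMeasurable F (μ.restrict B) := AEMeasurable.tsum fun h =>
    (hint (t + h)).aestronglyMeasurable.aemeasurable.ennreal_ofReal.restrict
  have hsub : Z ∩ B ⊆ {ω | ENNReal.ofReal y ≤ F ω} ∩ B := by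
    rintro ω ⟨hZ, hω⟩
    refine ⟨?_, hω⟩
    have h1 : y ≤ (r ^ t)⁻¹ * (S.randomArcCount G0 ξ t ω ⬝ᵥ v) := by
      have := mul_card_le_dotProduct (ξ := ξ) G0 (fun i => ha i (Finset.mem_univ i)) t ω
      rw [show randomNetwork G0 ξ t ω = G from hω] at this
      exact mul_le_mul_of_nonneg_left this (by positivity)
    have h2 : ∀ h, ENNReal.ofReal y ≤ ENNReal.ofReal
        ((r ^ (t + h))⁻¹ * (S.randomArcCount G0 ξ (t + h) ω ⬝ᵥ v)) + F ω := by
      intro h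
      refine (ENNReal.ofReal_le_ofReal
        (h1.trans (dotProduct_le_add_scaledDeviation G0 hv0 hr hv t h ω))).trans ?_
      refine ENNReal.ofReal_add_le.trans (add_le_add_right ?_ _)
      rw [ENNReal.ofReal_sum_of_nonneg fun s _ => scaledDeviation_nonneg G0 hv0 hr _ ω]
      exact ENNReal.sum_le_tsum _
    have h3 : Tendsto (fun h => ENNReal.ofReal
        ((r ^ (t + h))⁻¹ * (S.randomArcCount G0 ξ (t + h) ω ⬝ᵥ v)) + F ω) atTop
        (𝓝 (0 + F ω)) := by
      refine Tendsto.add ?_ tendsto_const_nhds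
      rw [← ENNReal.ofReal_zero]
      refine ENNReal.tendsto_ofReal (hZ.comp ?_)
      exact (tendsto_add_atTop_nat t).congr fun h => add_comm h t
    rw [zero_add] at h3
    exact ge_of_tendsto' h3 h2
  have hmarkov := (mul_meas_ge_le_lintegral₀ hF (ENNReal.ofReal y)).trans
    (hle t G B (SubstitutionRules.measurableSet_randomNetwork_eq G0 t G) (fun ω hω => hω) hG)
  rw [Measure.restrict_apply' hB] at hmarkov
  have hP : 0 ≤ μ.real B := measureReal_nonneg
  have h4 : y * μ.real (Z ∩ B) ≤ C * ((r ^ t)⁻¹ * (μ.real B * √N)) := by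
    have h5 := ENNReal.toReal_mono ENNReal.ofReal_ne_top hmarkov
    rw [ENNReal.toReal_mul, ENNReal.toReal_ofReal (by positivity),
      ENNReal.toReal_ofReal (by positivity)] at h5
    refine le_trans ?_ h5
    exact mul_le_mul_of_nonneg_left (measureReal_mono hsub) (by positivity)
  have h6 : (r ^ t)⁻¹ * (v a * √N) * (√N * μ.real (Z ∩ B)) ≤
      (r ^ t)⁻¹ * (v a * √N) * (C / v a * μ.real B) := by
    have e1 : (r ^ t)⁻¹ * (v a * √N) * (√N * μ.real (Z ∩ B)) = y * μ.real (Z ∩ B) := by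
      rw [hy]
      conv_rhs => rw [← Real.mul_self_sqrt hN.le]
      ring
    have e2 : (r ^ t)⁻¹ * (v a * √N) * (C / v a * μ.real B) =
        C * ((r ^ t)⁻¹ * (μ.real B * √N)) := by
      field_simp
    rwa [e1, e2]
  exact le_of_mul_le_mul_left h6 (by positivity)

/-- Almost surely, the normalized weighted number of arcs does not tend to zero. -/
theorem ae_not_tendsto_zero (hξ : S.IsRandomChoice μ ξ) (hS : S.Admissible) [Nonempty (Fin L)]
    (hG0 : Nonempty G0.E) {v : Fin L → ℝ} (hv0 : ∀ i, 0 < v i) {r : ℝ} (hr : 1 < r)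
    (hv : S.arcMatrix *ᵥ v = r • v) :
    ∀ᵐ ω ∂μ, ¬ Tendsto
      (fun s => (r ^ s)⁻¹ * (S.randomArcCount G0 ξ s ω ⬝ᵥ v)) atTop (𝓝 0) := by
  obtain ⟨C, hC, hle⟩ := hξ.exists_measureReal_extinction_le G0 hv0 hr hv
  obtain ⟨q, hq0, hq1, hq⟩ := hξ.exists_integral_half_pow_card_le G0 hS hG0
  set Z := {ω | Tendsto (fun s => (r ^ s)⁻¹ * (S.randomArcCount G0 ξ s ω ⬝ᵥ v)) atTop (𝓝 0)}
  -- Networks with at least `K` arcs contribute at most C/√K by the extinction estimate. Those with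
  -- at most `K` arcs satisfy `2 ^ K * (1 / 2) ^ N ≥ 1`, so their probability is controlled by the
  -- decay of the expectation of 2⁻ᴺ. Only monotonicity and subadditivity are applied to `Z`, so its
  -- measurability is not needed.
  have hbound : ∀ K t : ℕ, 1 ≤ K → μ.real Z ≤ C * (√K)⁻¹ + 2 ^ K * q ^ t := by
    intro K t hK
    have hK0 : (0 : ℝ) < K := by exact_mod_cast hK
    have hint : Integrable (fun ω =>
        (1 / 2 : ℝ) ^ Fintype.card (randomNetwork G0 ξ t ω).E) μ :=
      hξ.integrable_comp_randomNetwork G0 t fun G => (1 / 2 : ℝ) ^ Fintype.card G.E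
    have hint2 : Integrable (fun ω => C * (√K)⁻¹ +
        2 ^ K * (1 / 2 : ℝ) ^ Fintype.card (randomNetwork G0 ξ t ω).E) μ :=
      (integrable_const _).add (hint.const_mul _)
    have hG : ∀ G, μ.real (Z ∩ {ω | randomNetwork G0 ξ t ω = G}) ≤
        ∫ ω in Set.univ ∩ {ω | randomNetwork G0 ξ t ω = G}, (C * (√K)⁻¹ +
          2 ^ K * (1 / 2 : ℝ) ^ Fintype.card (randomNetwork G0 ξ t ω).E) ∂μ := by
      intro G
      rw [Set.univ_inter]
      set B := {ω | randomNetwork G0 ξ t ω = G}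
      have hB : MeasurableSet B := hξ.measurableSet_randomNetwork_eq G0 t G
      have hR : ∫ ω in B, (C * (√K)⁻¹ +
            2 ^ K * (1 / 2 : ℝ) ^ Fintype.card (randomNetwork G0 ξ t ω).E) ∂μ =
          ∫ _ in B, (C * (√K)⁻¹ + 2 ^ K * (1 / 2 : ℝ) ^ Fintype.card G.E) ∂μ :=
        setIntegral_congr_fun hB fun ω hω => by
          rw [show randomNetwork G0 ξ t ω = G from hω]
      rw [hR, setIntegral_const, smul_eq_mul]
      have hP : 0 ≤ μ.real B := measureReal_nonneg
      rcases le_total (Fintype.card G.E) K with h | h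
      · have h1 : (1 : ℝ) ≤ 2 ^ K * (1 / 2) ^ Fintype.card G.E := by
          rw [one_div, inv_pow, ← div_eq_mul_inv, one_le_div (by positivity)]
          exact pow_le_pow_right₀ one_le_two h
        have h2 : 0 ≤ C * (√K)⁻¹ := by positivity
        have h3 : μ.real (Z ∩ B) ≤ μ.real B := measureReal_mono Set.inter_subset_right
        nlinarith
      · have h1 := hle t G (hK.trans h)
        have h2 : √(K : ℝ) ≤ √(Fintype.card G.E : ℝ) :=
          Real.sqrt_le_sqrt (by exact_mod_cast h)
        have h3 : √(K : ℝ) * μ.real (Z ∩ B) ≤ C * μ.real B :=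
          (mul_le_mul_of_nonneg_right h2 measureReal_nonneg).trans h1
        have h4 : μ.real (Z ∩ B) ≤ μ.real B * (C * (√K)⁻¹) := by
          rw [← mul_assoc, ← div_eq_mul_inv, le_div_iff₀ (by positivity)]
          linarith
        refine h4.trans (mul_le_mul_of_nonneg_left ?_ hP)
        have : (0 : ℝ) ≤ 2 ^ K * (1 / 2) ^ Fintype.card G.E := by positivity
        linarith
    set F := (finite_range_randomNetwork (ξ := ξ) G0 t).toFinset
    have hcover : Z ⊆ ⋃ G ∈ F, Z ∩ {ω | randomNetwork G0 ξ t ω = G} := by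
      intro ω hω
      simp only [Set.mem_iUnion]
      exact ⟨_, (finite_range_randomNetwork G0 t).mem_toFinset.2 ⟨ω, rfl⟩, hω, rfl⟩
    calc μ.real Z ≤ μ.real (⋃ G ∈ F, Z ∩ {ω | randomNetwork G0 ξ t ω = G}) :=
          measureReal_mono hcover (measure_ne_top _ _)
      _ ≤ ∑ G ∈ F, μ.real (Z ∩ {ω | randomNetwork G0 ξ t ω = G}) :=
          measureReal_biUnion_finset_le _ _
      _ ≤ _ := Finset.sum_le_sum fun G _ => hG G
      _ = ∫ ω in Set.univ, (C * (√K)⁻¹ +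
          2 ^ K * (1 / 2 : ℝ) ^ Fintype.card (randomNetwork G0 ξ t ω).E) ∂μ :=
          (hξ.setIntegral_eq_sum_randomNetwork G0 t hint2 MeasurableSet.univ).symm
      _ = C * (√K)⁻¹ +
          2 ^ K * ∫ ω, (1 / 2 : ℝ) ^ Fintype.card (randomNetwork G0 ξ t ω).E ∂μ := by
          rw [setIntegral_univ, integral_add (integrable_const _) (hint.const_mul _),
            integral_const, probReal_univ, one_smul, integral_const_mul]
      _ ≤ C * (√K)⁻¹ + 2 ^ K * q ^ t := by
          gcongr
          exact hq t
  -- First `t` tends to infinity with `K` fixed, then `K` does.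
  have hK : ∀ K : ℕ, 1 ≤ K → μ.real Z ≤ C * (√K)⁻¹ := by
    intro K hK
    have hlim : Tendsto (fun t : ℕ => C * (√K)⁻¹ + 2 ^ K * q ^ t) atTop
        (𝓝 (C * (√K)⁻¹ + 2 ^ K * 0)) :=
      ((tendsto_pow_atTop_nhds_zero_of_lt_one hq0 hq1).const_mul _).const_add _
    rw [mul_zero, add_zero] at hlim
    exact ge_of_tendsto' hlim fun t => hbound K t hK
  have hlim : Tendsto (fun K : ℕ => C * (√K)⁻¹) atTop (𝓝 (C * 0)) :=
    ((Real.tendsto_sqrt_atTop.comp tendsto_natCast_atTop_atTop).inv_tendsto_atTop).const_mul C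
  rw [mul_zero] at hlim
  have hZ0 : μ.real Z ≤ 0 := ge_of_tendsto hlim ((eventually_ge_atTop 1).mono hK)
  have : μ Z = 0 := (measureReal_eq_zero_iff (measure_ne_top μ Z)).1
    (le_antisymm hZ0 measureReal_nonneg)
  exact measure_eq_zero_iff_ae_notMem.1 this

end IsRandomChoice

end SubstitutionRules

/-! ### Comparison of the arc counts with their means -/

theorem Matrix.IsPrimitive.smul {ι : Type*} [Fintype ι] [DecidableEq ι] {M : Matrix ι ι ℝ}
    (hM : M.IsPrimitive) {c : ℝ} (hc : 0 < c) : (c • M).IsPrimitive := by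
  obtain ⟨hnn, k, hk, hpos⟩ := hM
  refine ⟨fun i j => mul_nonneg hc.le (hnn i j), k, hk, fun i j => ?_⟩
  rw [smul_pow]
  exact mul_pos (pow_pos hc k) (hpos i j)

theorem mainTheorem6 {L : ℕ} (S : SubstitutionRules L) (hS : S.Admissible)
    (hM : S.arcMatrix.IsPrimitive)
    (G0 : ColoredNetwork L) (hG0 : Nonempty G0.E)
    {Ω : Type*} [MeasurableSpace Ω] (μ : Measure Ω) [IsProbabilityMeasure μ]
    (ξ : ℕ → ℕ → (i : Fin L) → Ω → Fin (S.q i)) (hξ : S.IsRandomChoice μ ξ) :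
    (∀ t j, Integrable (fun ω => S.randomArcCount G0 ξ t ω j) μ ∧
      ∫ ω, S.randomArcCount G0 ξ t ω j ∂μ =
        Matrix.vecMul (fun i => (G0.arcCount i : ℝ)) (S.arcMatrix ^ t) j) ∧
    ∀ᵐ ω ∂μ, VectorAsymp (fun t j => S.randomArcCount G0 ξ t ω j)
      (fun t j => ∫ ω', S.randomArcCount G0 ξ t ω' j ∂μ) := by
  have : Nonempty (Fin L) := hG0.map G0.color
  have hint := hξ.integrable_randomArcCount G0
  have hmean := hξ.integral_randomArcCount G0
  refine ⟨fun t j => ⟨hint t j, hmean t j⟩, ?_⟩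
  obtain ⟨r, hr0, u, v, hu, hv, hMv, huM, huv⟩ := hM.exists_perron
  have hr : 1 < r := hS.one_lt_of_left_eigenvector hu huM
  have hT := hM.smul (inv_pos.2 hr0)
  have hTv : Matrix.mulVec (r⁻¹ • S.arcMatrix) v = v := by
    rw [Matrix.smul_mulVec, hMv, smul_smul, inv_mul_cancel₀ hr0.ne', one_smul]
  have huT : Matrix.vecMul u (r⁻¹ • S.arcMatrix) = u := by
    rw [Matrix.vecMul_smul, huM, smul_smul, inv_mul_cancel₀ hr0.ne', one_smul]
  set x : Fin L → ℝ := fun i => (G0.arcCount i : ℝ)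
  -- The normalized means are an exact orbit of M/r, so the perturbation is zero.
  obtain ⟨W', hW', hW'j⟩ := tendsto_of_summable_perturbation hu hv huv hT hTv huT
    (Y := fun t => (r ^ t)⁻¹ • Matrix.vecMul x (S.arcMatrix ^ t)) (by
      refine summable_zero.congr fun t => ?_
      rw [Matrix.smul_vecMul, Matrix.vecMul_smul, Matrix.vecMul_vecMul, smul_smul, ← mul_inv,
        ← pow_succ, ← pow_succ, sub_self]
      simp [weightedNorm])
  have hx : W' = dotProduct x v := by
    refine tendsto_nhds_unique hW' (tendsto_const_nhds.congr fun t => ?_)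
    have : ∀ t : ℕ, Matrix.mulVec (S.arcMatrix ^ t) v = r ^ t • v := by
      intro t
      induction t with
      | zero => simp
      | succ t ih =>
        rw [pow_succ, ← Matrix.mulVec_mulVec, hMv, Matrix.mulVec_smul, ih, smul_smul, pow_succ']
    rw [smul_dotProduct, ← Matrix.dotProduct_mulVec, this, dotProduct_smul, smul_smul,
      inv_mul_cancel₀ (pow_pos hr0 t).ne', one_smul]
  have hW'0 : 0 < W' := by
    rw [hx, dotProduct, G0.sum_arcCount_mul v]
    exact Finset.sum_pos (fun e _ => hv _) (Finset.univ_nonempty_iff.2 hG0)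
  filter_upwards [hξ.ae_summable_scaledDeviation G0 hG0 hv hr hMv,
    hξ.ae_not_tendsto_zero G0 hS hG0 hv hr hMv] with ω hsum hne
  simp only [SubstitutionRules.scaledDeviation_eq G0 hr] at hsum
  obtain ⟨W, hW, hWj⟩ := tendsto_of_summable_perturbation hu hv huv hT hTv huT
    (Y := fun t => (r ^ t)⁻¹ • S.randomArcCount G0 ξ t ω) hsum
  simp only [smul_dotProduct, smul_eq_mul] at hW
  have hW0 : 0 < W := by
    refine lt_of_le_of_ne (ge_of_tendsto' hW fun t => ?_) fun h => hne (h ▸ hW)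
    exact mul_nonneg (by positivity)
      (Finset.sum_nonneg fun i _ => mul_nonneg (Nat.cast_nonneg _) (hv i).le)
  -- The entries of `u` cancel between the two limits, which makes the constant the same for all
  -- colors.
  refine ⟨W / W', div_pos hW0 hW'0, fun j => ?_⟩
  have hlim := (hWj j).div (hW'j j) (mul_pos hW'0 (hu j)).ne'
  rw [mul_div_mul_right _ _ (hu j).ne'] at hlim
  refine hlim.congr fun t => ?_
  simp only [hmean, Pi.smul_apply, smul_eq_mul]
  exact mul_div_mul_left _ _ (inv_ne_zero (pow_pos hr0 t).ne')
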